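/- **Setting.** A rate-distortion problem is given by a source distribution $p$ on $N\ge 1$ letters $x$ and a finite distortion $d(x,\hat x)$ with $M\ge 1$ reproduction letters $\hat x$. The Blahut–Arimoto operator is $$BA_\beta[r](\hat x)=r(\hat x)\sum_x \frac{p(x)e^{-\beta d(x,\hat x)}}{\sum_{\hat x'}r(\hat x')e^{-\beta d(x,\hat x')}} .$$ *Root tracking of order $l\ge 1$ with tensor memorization* starts from a root $r_{\beta_0}$ of $F=\mathrm{Id}-BA_{\beta_0}$, a step $\Delta\beta<0$ and a threshold $0<\delta<1$. While the current marginal $r$ has more than one letter in its support and $\beta>0$, it (i) reduces the problem to the support of $r$; (ii) while every $r(\hat x)>\delta$ and $\beta>0$, computes the implicit derivatives $\frac{d^k r}{d\beta^k}$, $k=1,\dots,l$, outputs the Taylor polynomial, and replaces $(r,\beta)$ by $\bigl(r+\sum_{k=1}^l\frac{\Delta\beta^k}{k!}\frac{d^kr}{d\beta^k},\ \beta+\Delta\beta\bigr)$; (iii) sets to $0$ every $r(\hat x)<\delta$, normalizes $r$, and iterates $BA_\beta$ until convergence. The derivatives are computed recursively from $$D_rF\Bigl[\tfrac{d^k r}{d\beta^k}\Bigr]=-\sum\frac{k!}{b!\,(t_1-b)!\,t_2!\cdots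 t_k!\,\prod_j (j!)^{t_j}}\;D^{m}_{\beta^b,r^{m-b}}F\Bigl[\bigl(\tfrac{dr}{d\beta}\bigr)_{\times(t_1-b)},\bigl(\tfrac{d^2r}{d\beta^2}\bigr)_{\times t_2},\dots\Bigr],$$ the sum being over the partitions $\sum_j j\,t_j=k$, with $m=\sum_j t_j$, and $0\le b\le t_1$, without the term $m=1,\ b=0$; the linear equations are solved by Gaussian elimination. The derivative tensors of $F$ are computed by explicit closed formulas, each at its first appearance only, and those which are needed again are memorized. Costs are counted on a real random-access machine with unit-cost operations. Memory is the largest number of cells in use simultaneously, not counting the output. The grid points are the values $\beta_0,\beta_0+\Delta\beta,\dots$ visited. The derivation of the problem-independent polynomials that enter the closed formulas is not counted; storing them is. **Theorem.** There is an absolute constant $C$ such that the following holds for all $l,M,N\ge1$ and every input. Let $G$ be the number of grid points and $I$ the total number of Blahut–Arimoto iterations done in the steps (iii). 1. If $l\ge 2$, the number of operations is at most $$C\Bigl(G\cdot N\,(M+l)^{3l+5/2}\,e^{(2M+l)H_e(\rho)+\pi\sqrt{2l/3}}+I\cdot MN\Bigr),\qquad \rho=\frac{2M}{2M+l},$$ where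 $H_e(\rho)=-\rho\ln\rho-(1-\rho)\ln(1-\rho)$. 2. If $l=1$, it is at most $C\,(G\cdot M^3N+I\cdot MN)$. 3. The memory is at most $C\,\bigl(l^{\,l+5/2}\ln l+MNl^2+M^l\,l\bigr)$; for $l=1$ this is under the assumption that the Jacobian $D_rF$ of the problem reduced to the support of $r_{\beta_0}$ is nonsingular at $(r_{\beta_0},\beta_0)$. -/

import Mathlib

noncomputable section

namespace RDTracking

/-! ## The Blahut-Arimoto operator -/

/-- One iteration of the Blahut-Arimoto algorithm in the coordinates of the reproduction
marginal `r`, for the source `p` and the distortion `d x y`. -/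
def blahutArimoto {X Y : Type*} [Fintype X] [Fintype Y]
    (d : X → Y → ℝ) (p : X → ℝ) (β : ℝ) (r : Y → ℝ) : Y → ℝ :=
  fun y => r y * ∑ x, p x * Real.exp (-(β * d x y)) / ∑ y', r y' * Real.exp (-(β * d x y'))

/-- `r` is a distribution and a root of `Id - BA_β`, and the Jacobian of `Id - BA_β` of the problem
reduced to the support of `r` is nonsingular at `r`. -/
def IsNonsingularRoot {X Y : Type*} [Fintype X] [Fintype Y]
    (d : X → Y → ℝ) (p : X → ℝ) (β : ℝ) (r : Y → ℝ) : Prop :=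
  r ∈ stdSimplex ℝ Y ∧ blahutArimoto d p β r = r ∧
    ∀ S : Finset Y, (∀ y, y ∈ S ↔ r y ≠ 0) →
      Function.Bijective
        (fderiv ℝ (fun s : S → ℝ => s - blahutArimoto (fun x (y : S) => d x y) p β s)
          (fun y : S => r y))

/-! ## The machine

A real random-access machine with unit-cost operations. All real arrays are blocks of memory cells
which are taken from, and returned to, a stack. Values bound in a program are registers; lists of
natural numbers bound in a program (multi-indices, partitions, index tuples) are integer arrays,
for which cells are reserved as well. -/

structure Machine where
  /-- contents of the memory cells -/
  mem : ℕ → ℝ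
  /-- number of cells in use -/
  brk : ℕ
  /-- largest number of cells that were in use simultaneously -/
  peak : ℕ
  /-- number of elementary operations done -/
  time : ℕ
  /-- write-only output stream, most recent item first; it is not part of the memory -/
  out : List ℝ
  /-- number of Taylor steps done -/
  taylorSteps : ℕ
  /-- number of Blahut-Arimoto iterations done -/
  baIters : ℕ

abbrev Prog (α : Type) : Type := StateM Machine α

/-! ### Elementary operations -/

def tick (n : ℕ) : Prog Unit := modify fun s => { s with time := s.time + n }

def radd (a b : ℝ) : Prog ℝ := do tick 1; pure (a + b)

def rsub (a b : ℝ) : Prog ℝ := do tick 1; pure (a - b)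

def rmul (a b : ℝ) : Prog ℝ := do tick 1; pure (a * b)

def rdiv (a b : ℝ) : Prog ℝ := do tick 1; pure (a / b)

def rexp (a : ℝ) : Prog ℝ := do tick 1; pure (Real.exp a)

def lit (n : ℕ) : Prog ℝ := do tick 1; pure (n : ℝ)

open Classical in
def rlt (a b : ℝ) : Prog Bool := do tick 1; pure (decide (a < b))

open Classical in
def isZero (a : ℝ) : Prog Bool := do tick 1; pure (decide (a = 0))

def readCell (a : ℕ) : Prog ℝ := do
  tick 1
  let s ← get
  pure (s.mem a)

def writeCell (a : ℕ) (v : ℝ) : Prog Unit :=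
  modify fun s => { s with time := s.time + 1, mem := fun i => if i = a then v else s.mem i }

def emit (v : ℝ) : Prog Unit :=
  modify fun s => { s with time := s.time + 1, out := v :: s.out }

/-- Read an entry of an integer array. -/
def idx (xs : List ℕ) (i : ℕ) : Prog ℕ := do tick 1; pure (xs.getD i 0)

/-- Reserve `n` cells, initialised to `0` at a cost of `n` operations, while `body` is running;
`body` gets the address of the first of them. -/
def withCells {α : Type} (n : ℕ) (body : ℕ → Prog α) : Prog α := do
  let base := (← get).brk
  modify fun s => { s with
    brk := base + n
    peak := max s.peak (base + n)
    time := s.time + n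
    mem := fun i => if base ≤ i ∧ i < base + n then 0 else s.mem i }
  let v ← body base
  modify fun s => { s with brk := base }
  pure v

/-- Run `body 0, …, body (n - 1)`. -/
def loop : ℕ → (ℕ → Prog Unit) → Prog Unit
  | 0, _ => pure ()
  | n + 1, body => do
    loop n body
    tick 1
    body n

def sumLoop : ℕ → (ℕ → Prog ℝ) → Prog ℝ
  | 0, _ => lit 0
  | n + 1, f => do
    let s ← sumLoop n f
    let v ← f n
    radd s v

def prodLoop : ℕ → (ℕ → Prog ℝ) → Prog ℝ
  | 0, _ => lit 1
  | n + 1, f => do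
    let s ← prodLoop n f
    let v ← f n
    rmul s v

/-- `x ^ n` by repeated multiplication. -/
def rpowNat (x : ℝ) (n : ℕ) : Prog ℝ := prodLoop n fun _ => pure x

def listSum : List ℕ → Prog ℕ
  | [] => do tick 1; pure 0
  | a :: as => do
    let s ← listSum as
    tick 1
    pure (a + s)

/-! ### Enumerations by nested loops -/

/-- Run `body` on all `a ∈ ℕ₀ⁿ` with `|a| = rem` (prepended to `acc`). -/
def forComps : ℕ → ℕ → List ℕ → (List ℕ → Prog Unit) → Prog Unit
  | 0, rem, acc, body => do
    tick 1
    if rem = 0 then body acc else pure ()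
  | 1, rem, acc, body => withCells 1 fun _ => do
    tick 1
    body (rem :: acc)
  | n + 2, rem, acc, body => loop (rem + 1) fun a => withCells 1 fun _ =>
    forComps (n + 1) (rem - a) (a :: acc) body

/-- `forParts k k [] body` runs `body` on all integer partitions of `k`, written by multiplicity
as `[t₁, …, tₖ]` with `∑ j, j * tⱼ = k`. -/
def forParts : ℕ → ℕ → List ℕ → (List ℕ → Prog Unit) → Prog Unit
  | 0, rem, acc, body => do
    tick 1
    if rem = 0 then body acc else pure ()
  | 1, rem, acc, body => withCells 1 fun _ => do
    tick 1
    body (rem :: acc)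
  | j + 2, rem, acc, body => loop (rem / (j + 2) + 1) fun c => withCells 1 fun _ =>
    forParts (j + 1) (rem - c * (j + 2)) (c :: acc) body

/-- Run `body` on the positions, in an array with `t` axes of length `M`, of all index tuples
`(i₁, …, i_t)` in which each `i` occurs `α i` times. -/
def forArrangements (M : ℕ) : ℕ → List ℕ → ℕ → (ℕ → Prog Unit) → Prog Unit
  | 0, _, off, body => body off
  | t + 1, α, off, body => loop M fun i => do
    let a ← idx α i
    if a = 0 then pure () else
      withCells 1 fun _ => do
        tick 4
        forArrangements M t (α.set i (a - 1)) (off * M + i) body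

/-! ## The polynomials `P_k`

A polynomial is a list of monomials with coefficients `1` and `-1`; a monomial is a sign
(`true` for `-1`) and the list of the indices of its variables. -/

/-- The derivation with `x₀ ↦ 0` and `x_k ↦ x₁ x_k - x_{k+1}`, applied to a monomial. -/
def dbar (u : Bool × List ℕ) : List (Bool × List ℕ) :=
  (List.range u.2.length).flatMap fun i =>
    if u.2.getD i 0 = 0 then []
    else [(u.1, 1 :: u.2), (!u.1, u.2.set i (u.2.getD i 0 + 1))]

/-- `P₀ = 1` and `P_{k+1} = (x₁ - x₀) P_k + dbar P_k`. -/
def polyP : ℕ → List (Bool × List ℕ)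
  | 0 => [(false, [])]
  | k + 1 => (polyP k).flatMap fun u => (u.1, 1 :: u.2) :: (!u.1, 0 :: u.2) :: dbar u

/-- Number of cells needed to store `P₀, …, P_l`: one per sign and one per variable occurrence. -/
def polyCells (l : ℕ) : ℕ :=
  ∑ k ∈ Finset.range (l + 1), ((polyP k).map fun u => 1 + u.2.length).sum

/-! ## The algorithm at a grid point -/

/-- Sizes and the addresses of the arrays. Throughout, `i < M` is a reproduction letter and
`x < N` is a source letter. -/
structure Ctx where
  /-- the order of the Taylor method -/
  l : ℕ
  /-- size of the source alphabet -/
  N : ℕ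
  /-- size of the (reduced) reproduction alphabet -/
  M : ℕ
  /-- distortion `d(x, i)`, at `aD + i * N + x` -/
  aD : ℕ
  /-- source distribution, at `aP + x` -/
  aP : ℕ
  /-- reproduction marginal, at `aR + i` -/
  aR : ℕ
  /-- factorials, `k!` at `aF + k` -/
  aF : ℕ
  /-- encoder `q(i | x)`, at `aQ + i * N + x` -/
  aQ : ℕ
  /-- expectations of the `k`-th power of the distortion, at `aE + k * N + x` -/
  aE : ℕ
  /-- matrices `P_k(i, x)`, at `aPk + (k * M + i) * N + x` -/
  aPk : ℕ
  /-- matrices `G(k, a)`, at `aG + ((k * (l + 2) + a) * M + i) * N + x` -/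
  aG : ℕ
  /-- implicit derivatives of order `k`, at `aX + k * M + i` -/
  aX : ℕ
  /-- memorized derivative tensors -/
  aT : ℕ

/-- Factorials `0!, …, l!`. -/
def computeFactorials (c : Ctx) : Prog Unit := do
  writeCell c.aF (← lit 1)
  loop c.l fun k => do
    let f ← readCell (c.aF + k)
    let v ← rmul f (← lit (k + 1))
    writeCell (c.aF + (k + 1)) v

/-- The encoder `q(i | x) = r(i) exp (-β d(x, i)) / Z(x, β)`. -/
def computeEncoder (c : Ctx) (β : ℝ) : Prog Unit := do
  loop c.M fun i => loop c.N fun x => do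
    let y ← rmul β (← readCell (c.aD + i * c.N + x))
    let e ← rexp (← rsub 0 y)
    let v ← rmul (← readCell (c.aR + i)) e
    writeCell (c.aQ + i * c.N + x) v
  loop c.N fun x => do
    let z ← sumLoop c.M fun i => readCell (c.aQ + i * c.N + x)
    loop c.M fun i => do
      let v ← rdiv (← readCell (c.aQ + i * c.N + x)) z
      writeCell (c.aQ + i * c.N + x) v

/-- The expectations `∑ i, q(i | x) d(x, i) ^ k` for `1 ≤ k ≤ l`. -/
def computeExpectations (c : Ctx) : Prog Unit :=
  withCells (c.M * c.N) fun aW => do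
    loop c.M fun i => loop c.N fun x => do
      writeCell (aW + i * c.N + x) (← lit 1)
    loop c.l fun k => do
      loop c.M fun i => loop c.N fun x => do
        let w ← readCell (aW + i * c.N + x)
        let v ← rmul w (← readCell (c.aD + i * c.N + x))
        writeCell (aW + i * c.N + x) v
      loop c.N fun x => do
        let e ← sumLoop c.M fun i => do
          let q ← readCell (c.aQ + i * c.N + x)
          let w ← readCell (aW + i * c.N + x)
          rmul q w
        writeCell (c.aE + (k + 1) * c.N + x) e

/-- Value of a monomial at `x₀ = d(x, i)` and `x_k = E[d(x, ·) ^ k]`. -/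
def evalWord (c : Ctx) (i x : ℕ) : List ℕ → Prog ℝ
  | [] => lit 1
  | v :: w => do
    let y ← readCell (if v = 0 then c.aD + i * c.N + x else c.aE + v * c.N + x)
    let z ← evalWord c i x w
    rmul y z

def evalPoly (c : Ctx) (i x : ℕ) : List (Bool × List ℕ) → Prog ℝ
  | [] => lit 0
  | u :: us => do
    let s ← evalPoly c i x us
    let v ← evalWord c i x u.2
    if u.1 then rsub s v else radd s v

/-- The matrices `P_k(i, x)` for `k ≤ l`. -/
def computeP (c : Ctx) : Prog Unit :=
  loop (c.l + 1) fun k => loop c.M fun i => loop c.N fun x => do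
    let v ← evalPoly c i x (polyP k)
    writeCell (c.aPk + (k * c.M + i) * c.N + x) v

/-- The matrices
`G(k, a)(i, x) = ∑ t, 1 / (t! (a - |t|)!) * ∏ j, (P_j(i, x) / j!) ^ t_j`, summed over the partitions
`t` of `k` with `|t| ≤ a`, for `k ≤ l` and `a ≤ l + 1`. Each partition is visited once. -/
def computeG (c : Ctx) : Prog Unit :=
  loop (c.l + 1) fun k => forParts k k [] fun t => do
    let m ← listSum t
    loop c.M fun i => loop c.N fun x => do
      let w ← prodLoop k fun j => do
        let tj ← idx t j
        let y ← readCell (c.aPk + ((j + 1) * c.M + i) * c.N + x)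
        let z ← rdiv y (← readCell (c.aF + (j + 1)))
        let u ← rpowNat z tj
        rdiv u (← readCell (c.aF + tj))
      let invf ← lit 1
      -- the running value of `1 / (a - |t|)!` is kept in one cell
      withCells 1 fun cell => do
        writeCell cell invf
        loop (c.l + 2 - m) fun e => do
          let f ← readCell cell
          let g ← readCell (c.aG + ((k * (c.l + 2) + (m + e)) * c.M + i) * c.N + x)
          let g' ← radd g (← rmul w f)
          writeCell (c.aG + ((k * (c.l + 2) + (m + e)) * c.M + i) * c.N + x) g'
          let f' ← rdiv f (← lit (e + 1))
          writeCell cell f'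

/-! ### Derivative tensors of `Id - BA_β` -/

def readG (c : Ctx) (k a i x : ℕ) : Prog ℝ :=
  readCell (c.aG + ((k * (c.l + 2) + a) * c.M + i) * c.N + x)

/-- The derivative of order `b` in `β` alone, at coordinate `i`. -/
def calcBetaDeriv (c : Ctx) (b i : ℕ) : Prog ℝ := do
  let s ← sumLoop c.N fun x => do
    let p ← readCell (c.aP + x)
    let q ← readCell (c.aQ + i * c.N + x)
    let y ← readCell (c.aPk + (b * c.M + i) * c.N + x)
    rmul (← rmul p q) y
  rsub 0 s

/-- The partial derivative of order `b` in `β` and of multi-index `α` in `r`, at coordinate `i`,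
where `t = |α| > 0`. -/
def calcMixedDeriv (c : Ctx) (b t : ℕ) (α : List ℕ) (i : ℕ) : Prog ℝ := do
  let ai ← idx α i
  let s ← sumLoop c.N fun x => do
    let p ← readCell (c.aP + x)
    let w ← prodLoop c.M fun j => do
      let aj ← idx α j
      let u ← rdiv (← readCell (c.aQ + j * c.N + x)) (← readCell (c.aR + j))
      rpowNat u aj
    let g ← withCells 1 fun cell => do
      forComps c.M b [] fun k => do
        let pr ← prodLoop c.M fun j =>
          if j = i then lit 1 else do
            let kj ← idx k j
            let aj ← idx α j
            readG c kj aj j x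
        let ki ← idx k i
        let u ← rmul (← lit ai) (← readG c ki ai i x)
        let q ← readCell (c.aQ + i * c.N + x)
        let v ← rmul (← rmul (← lit (t * (1 + ai))) q) (← readG c ki (1 + ai) i x)
        let y ← rmul pr (← rsub u v)
        let y' ← radd (← readCell cell) y
        writeCell cell y'
      readCell cell
    rmul (← rmul p w) g
  let f ← prodLoop c.M fun j => do
    let aj ← idx α j
    readCell (c.aF + aj)
  let f' ← rmul (← rmul (← readCell (c.aF + (t - 1))) (← readCell (c.aF + b))) f
  let v ← rmul f' s
  let e ← lit (if b = 0 ∧ t = 1 ∧ ai = 1 then 1 else 0)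
  if t % 2 = 1 then rsub e v else radd e v

/-- Compute coordinate `i` of the tensor with `b` derivatives in `β` and `m - b` derivatives in `r`,
as an array with `m - b` axes which is stored at `base`. Every partial derivative is computed once
and copied to the entries of its index tuples. -/
def calcTensorRow (c : Ctx) (m b i base : ℕ) : Prog Unit :=
  if m - b = 0 then do
    let v ← calcBetaDeriv c b i
    writeCell base v
  else
    forComps c.M (m - b) [] fun α => do
      let v ← calcMixedDeriv c b (m - b) α i
      forArrangements c.M (m - b) α 0 fun off => writeCell (base + off) v

/-- Evaluate the multilinear form stored at `base` on the implicit derivatives whose orders are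
listed in the third argument. -/
def evalForm (c : Ctx) (base : ℕ) : List ℕ → ℕ → Prog ℝ
  | [], off => readCell (base + off)
  | k :: ks, off => withCells 1 fun _ => sumLoop c.M fun i => do
    let y ← readCell (c.aX + k * c.M + i)
    let v ← evalForm c base ks (off * c.M + i)
    rmul y v

/-- Cells of all the tensors of total order `m`. -/
def orderCells (M m : ℕ) : ℕ := ∑ b ∈ Finset.range (m + 1), M ^ (m - b + 1)

/-- Position of the tensor of total order `m` with `b` derivatives in `β` among the memorized
tensors. -/
def tensorOffset (M m b : ℕ) : ℕ :=
  ∑ m' ∈ Finset.Ico 1 m, orderCells M m' + ∑ b' ∈ Finset.range b, M ^ (m - b' + 1)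

/-- Cells for the memorized tensors. Those of total order `m < l` are memorized, and the Jacobian
(`m = 1`) always is; a tensor of the highest order `l` is used only once. -/
def tensorCells (M l : ℕ) : ℕ := ∑ m ∈ Finset.Icc 1 (max 1 (l - 1)), orderCells M m

/-- Coordinate `i` of a tensor of total order `m`, evaluated at the implicit derivatives of the
orders `args`, while computing the implicit derivative of order `k`. The tensor appears for the
first time if and only if `m = k`; it is then computed, and is memorized unless it is never used
again. Otherwise its memorized value is used. -/
def applyTensorRow (c : Ctx) (k m b i : ℕ) (args : List ℕ) : Prog ℝ := do
  tick ((m + 1) * (m + 1))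
  let stored := c.aT + tensorOffset c.M m b + i * c.M ^ (m - b)
  if m = k then
    if m < c.l ∨ m = 1 then do
      calcTensorRow c m b i stored
      evalForm c stored args 0
    else
      withCells (c.M ^ (m - b)) fun scratch => do
        calcTensorRow c m b i scratch
        evalForm c scratch args 0
  else
    evalForm c stored args 0

/-! ### Linear equations -/

/-- The first row `i` with `row ≤ i < row + n` and a nonzero entry in column `col` of the augmented
matrix with `M` rows and `M + 1` columns at `a`. -/
def findPivot (a M col : ℕ) : ℕ → ℕ → Prog (Option ℕ)
  | _, 0 => do tick 1; pure none
  | row, n + 1 => do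
    let z ← isZero (← readCell (a + row * (M + 1) + col))
    if z then findPivot a M col (row + 1) n else pure (some row)

/-- Gauss-Jordan elimination; the result lists the pairs (pivot column, pivot row). -/
def eliminate (a M : ℕ) : ℕ → ℕ → ℕ → List (ℕ × ℕ) → Prog (List (ℕ × ℕ))
  | 0, _, _, acc => pure acc
  | n + 1, col, row, acc => do
    let piv ← findPivot a M col row (M - row)
    match piv with
    | none => eliminate a M n (col + 1) row acc
    | some i => do
      loop (M + 1) fun j => do
        let u ← readCell (a + i * (M + 1) + j)
        let v ← readCell (a + row * (M + 1) + j)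
        writeCell (a + i * (M + 1) + j) v
        writeCell (a + row * (M + 1) + j) u
      let h ← readCell (a + row * (M + 1) + col)
      loop (M + 1) fun j => do
        let v ← rdiv (← readCell (a + row * (M + 1) + j)) h
        writeCell (a + row * (M + 1) + j) v
      loop M fun i' =>
        if i' = row then pure () else do
          let f ← readCell (a + i' * (M + 1) + col)
          loop (M + 1) fun j => do
            let y ← rmul f (← readCell (a + row * (M + 1) + j))
            let v ← rsub (← readCell (a + i' * (M + 1) + j)) y
            writeCell (a + i' * (M + 1) + j) v
      eliminate a M n (col + 1) (row + 1) ((col, row) :: acc)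

def writeSolution (a M dst : ℕ) : List (ℕ × ℕ) → Prog Unit
  | [] => pure ()
  | u :: us => do
    let v ← readCell (a + u.2 * (M + 1) + M)
    writeCell (dst + u.1) v
    writeSolution a M dst us

/-- Write to `dst` a linear pre-image of the vector at `rhs` under the `M × M` matrix at `mat`. -/
def solveLinear (M mat rhs dst : ℕ) : Prog Unit :=
  withCells (M * (M + 1)) fun a => withCells (2 * M) fun _ => do
    loop M fun i => do
      loop M fun j => do
        writeCell (a + i * (M + 1) + j) (← readCell (mat + i * M + j))
      writeCell (a + i * (M + 1) + M) (← readCell (rhs + i))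
    loop M fun i => do
      writeCell (dst + i) (← lit 0)
    let pivots ← eliminate a M M 0 0 []
    writeSolution a M dst pivots

/-! ### Implicit derivatives -/

/-- `k! / (b! (t₁ - b)! t₂! ⋯ (1!)^t₁ (2!)^t₂ ⋯)` for a partition `t` of `k`. -/
def partitionCoef (c : Ctx) (k b : ℕ) (t : List ℕ) : Prog ℝ := do
  let den ← prodLoop k fun j => do
    let tj ← idx t j
    let u ← if j = 0 then do
        rmul (← readCell (c.aF + b)) (← readCell (c.aF + (tj - b)))
      else readCell (c.aF + tj)
    let v ← rpowNat (← readCell (c.aF + (j + 1))) tj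
    rmul u v
  rdiv (← readCell (c.aF + k)) den

/-- The orders of the derivatives to which a tensor is applied: `t₁ - b` times order `1`, and
`tⱼ` times order `j` for `j ≥ 2`. -/
def formArgs (b : ℕ) (t : List ℕ) : List ℕ :=
  (List.range t.length).flatMap fun j =>
    List.replicate (if j = 0 then t.getD j 0 - b else t.getD j 0) (j + 1)

/-- The implicit derivative of order `k`, when those of orders `1, …, k - 1` are stored. -/
def implicitDeriv (c : Ctx) (k : ℕ) : Prog Unit :=
  withCells c.M fun res => do
    forParts k k [] fun t => do
      let m ← listSum t
      let m1 ← idx t 0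
      loop (m1 + 1) fun b =>
        if m = 1 ∧ b = 0 then pure () else do
          let coef ← partitionCoef c k b t
          withCells m fun _ => do
            tick (k + m)
            let args := formArgs b t
            loop c.M fun i => do
              let v ← applyTensorRow c k m b i args
              let y ← rsub (← readCell (res + i)) (← rmul coef v)
              writeCell (res + i) y
    -- the Jacobian appears for the first time when `k = 1`
    if k = 1 then loop c.M fun i => calcTensorRow c 1 0 i (c.aT + i * c.M) else pure ()
    solveLinear c.M c.aT res (c.aX + k * c.M)

/-- Computation at a grid point: initial computations, the implicit derivatives of orders
`1, …, l`, output of the point and of its Taylor expansion, and the step of length `Δβ`. -/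
def taylorStep (c₀ : Ctx) (β Δβ : ℝ) : Prog Unit :=
  let l := c₀.l
  let M := c₀.M
  let N := c₀.N
  withCells (l + 1) fun aF =>
  withCells (M * N) fun aQ =>
  withCells ((l + 1) * N) fun aE =>
  withCells ((l + 1) * M * N) fun aPk =>
  withCells ((l + 1) * (l + 2) * M * N) fun aG =>
  withCells ((l + 1) * M) fun aX =>
  withCells (tensorCells M l) fun aT => do
    let c : Ctx := { c₀ with aF := aF, aQ := aQ, aE := aE, aPk := aPk, aG := aG, aX := aX, aT := aT }
    computeFactorials c
    computeEncoder c β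
    computeExpectations c
    computeP c
    computeG c
    loop l fun k => implicitDeriv c (k + 1)
    emit β
    loop M fun i => do
      emit (← readCell (c.aR + i))
    loop l fun k => loop M fun i => do
      let v ← rdiv (← readCell (aX + (k + 1) * M + i)) (← readCell (aF + (k + 1)))
      emit v
    loop M fun i => do
      let s ← sumLoop l fun k => do
        let h ← rdiv (← rpowNat Δβ (k + 1)) (← readCell (aF + (k + 1)))
        rmul h (← readCell (aX + (k + 1) * M + i))
      let v ← radd (← readCell (c.aR + i)) s
      writeCell (c.aR + i) v
    modify fun s => { s with taylorSteps := s.taylorSteps + 1 }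

/-! ## Root tracking

The unbounded loops are cut off after `fuel` rounds. A cutoff that is large enough is of no effect
on a terminating run. -/

/-- Whether `δ < r(i)` for all `i < n`. -/
def allAbove (aR : ℕ) (δ : ℝ) : ℕ → Prog Bool
  | 0 => do tick 1; pure true
  | n + 1 => do
    let u ← allAbove aR δ n
    let v ← rlt δ (← readCell (aR + n))
    pure (u && v)

/-- Taylor's method until a cluster vanishes up to `δ`, or `β ≤ 0`. Returns the last `β`. -/
def trackToBifurcation (c : Ctx) (Δβ δ : ℝ) : ℕ → ℝ → Prog ℝ
  | 0, β => pure β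
  | fuel + 1, β => do
    let u ← allAbove c.aR δ c.M
    let v ← rlt 0 β
    if u && v then do
      taylorStep c β Δβ
      let β' ← radd β Δβ
      trackToBifurcation c Δβ δ fuel β'
    else pure β

/-- Size of the support of the marginal. -/
def supportSize (aR : ℕ) : ℕ → Prog ℕ
  | 0 => do tick 1; pure 0
  | n + 1 => do
    let u ← supportSize aR n
    let z ← isZero (← readCell (aR + n))
    pure (if z then u else u + 1)

/-- Reduce the marginal and the distortion to the support, in place. Returns its size. -/
def reduceToSupport (aD aR N : ℕ) : ℕ → Prog ℕ
  | 0 => do tick 1; pure 0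
  | n + 1 => do
    let j ← reduceToSupport aD aR N n
    let r ← readCell (aR + n)
    let z ← isZero r
    if z then pure j else do
      writeCell (aR + j) r
      loop N fun x => do
        writeCell (aD + j * N + x) (← readCell (aD + n * N + x))
      pure (j + 1)

/-- Set `r(i)` to zero wherever `r(i) < δ`, and normalize. -/
def truncateAndNormalize (c : Ctx) (δ : ℝ) : Prog Unit := do
  loop c.M fun i => do
    let z ← rlt (← readCell (c.aR + i)) δ
    if z then writeCell (c.aR + i) 0 else pure ()
  let s ← sumLoop c.M fun i => readCell (c.aR + i)
  loop c.M fun i => do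
    let v ← rdiv (← readCell (c.aR + i)) s
    writeCell (c.aR + i) v

/-- Whether `|u(i) - v(i)| ≤ tol` for all `i < n`. -/
def allClose (a a' : ℕ) (tol : ℝ) : ℕ → Prog Bool
  | 0 => do tick 1; pure true
  | n + 1 => do
    let w ← allClose a a' tol n
    let y ← rsub (← readCell (a + n)) (← readCell (a' + n))
    let u ← rlt tol y
    let v ← rlt tol (← rsub 0 y)
    pure (w && !u && !v)

/-- One Blahut-Arimoto iteration, in place. Returns whether the change is at most `tol`. -/
def blahutArimotoStep (c : Ctx) (β tol : ℝ) : Prog Bool :=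
  withCells (c.M * c.N) fun aQ => withCells c.M fun aS => do
    computeEncoder { c with aQ := aQ } β
    loop c.M fun i => do
      let s ← sumLoop c.N fun x => do
        rmul (← readCell (c.aP + x)) (← readCell (aQ + i * c.N + x))
      writeCell (aS + i) s
    let done ← allClose aS c.aR tol c.M
    loop c.M fun i => do
      writeCell (c.aR + i) (← readCell (aS + i))
    modify fun s => { s with baIters := s.baIters + 1 }
    pure done

/-- The Blahut-Arimoto algorithm: iterate until convergence. -/
def blahutArimotoLoop (c : Ctx) (β tol : ℝ) : ℕ → Prog Unit
  | 0 => pure ()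
  | fuel + 1 => do
    let done ← blahutArimotoStep c β tol
    if done then pure () else blahutArimotoLoop c β tol fuel

/-- The main loop: while the support is nontrivial and `β > 0`, reduce the problem to the support,
track the root to the next bifurcation, drop the vanished clusters, and correct by the
Blahut-Arimoto algorithm. -/
def trackRounds (c : Ctx) (Δβ δ tol : ℝ) (fuel : ℕ) : ℕ → ℕ → ℝ → Prog Unit
  | 0, _, _ => pure ()
  | n + 1, M, β => do
    let size ← supportSize c.aR M
    let pos ← rlt 0 β
    if 1 < size ∧ pos = true then do
      let M' ← reduceToSupport c.aD c.aR c.N M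
      let c' : Ctx := { c with M := M' }
      let β' ← trackToBifurcation c' Δβ δ fuel β
      truncateAndNormalize c' δ
      blahutArimotoLoop c' β' tol fuel
      trackRounds c Δβ δ tol fuel n M' β'
    else pure ()

/-- The initial state: the distortion, the source distribution and the root are in the memory. -/
def initialMachine {M N : ℕ} (d : Fin N → Fin M → ℝ) (p : Fin N → ℝ) (r₀ : Fin M → ℝ) : Machine where
  mem := fun a =>
    if h : a < M * N then
      d ⟨a % N, Nat.mod_lt _ (Nat.pos_of_ne_zero fun h0 => by simp [h0] at h)⟩
        ⟨a / N, Nat.div_lt_of_lt_mul (by rwa [Nat.mul_comm] at h)⟩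
    else if h : a - M * N < N then p ⟨a - M * N, h⟩
    else if h : a - M * N - N < M then r₀ ⟨a - M * N - N, h⟩
    else 0
  brk := M * N + N + M
  peak := M * N + N + M
  time := 0
  out := []
  taylorSteps := 0
  baIters := 0

/-- Root tracking for rate-distortion with Taylor's method of order `l` and with tensor
memorization, for the problem `(d, p)`, started at the root `r₀` at `β₀`, with step size `Δβ`, with
cluster mass threshold `δ`, and with tolerance `tol` for the convergence of Blahut-Arimoto. The
polynomials `P₀, …, P_l`, which depend on `l` only, are loaded to memory at the beginning. The
result is the final state of the machine. -/
def rootTracking (l : ℕ) {M N : ℕ} (d : Fin N → Fin M → ℝ) (p : Fin N → ℝ) (r₀ : Fin M → ℝ)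
    (β₀ Δβ δ tol : ℝ) (fuel : ℕ) : Machine :=
  let c : Ctx :=
    { l := l, N := N, M := M, aD := 0, aP := M * N, aR := M * N + N,
      aF := 0, aQ := 0, aE := 0, aPk := 0, aG := 0, aX := 0, aT := 0 }
  ((withCells (polyCells l) fun _ => trackRounds c Δβ δ tol fuel fuel M β₀).run
    (initialMachine d p r₀)).2

/-- Number of the grid points `β₀, β₀ + Δβ, …` that were visited. -/
def Machine.gridPoints (s : Machine) : ℕ := s.taylorSteps + 1

/-! ## The bounds -/

/-- The cost per grid point for orders `l ≥ 2`. -/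
def costBound (l M N : ℕ) : ℝ :=
  (N : ℝ) * ((M : ℝ) + l) ^ (3 * (l : ℝ) + 5 / 2) *
    Real.exp ((2 * (M : ℝ) + l) * Real.binEntropy (2 * (M : ℝ) / (2 * (M : ℝ) + l)) +
      Real.pi * Real.sqrt (2 * (l : ℝ) / 3))

/-- The bound on the memory. -/
def memoryBound (l M N : ℕ) : ℝ :=
  (l : ℝ) ^ ((l : ℝ) + 5 / 2) * Real.log l + (M : ℝ) * N * (l : ℝ) ^ 2 + (M : ℝ) ^ l * l

end RDTracking

end

/-! The program is bounded by a compositional cost calculus. Time adds up along sequential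
composition. Cells add up only along nesting, since every block is returned and successive pieces
reuse the same cells. The nested enumerations are counted crudely by geometric sums: at most `(M +
1) ^ b` multi-indices of weight `b`, and at most `4 ^ k` partitions of `k`.

Time. A Taylor step costs `O(4 ^ l * (l + 1) ^ 4 * N * (M + 1) ^ (2 * l + 1))` plus the evaluation
of the polynomials, which is governed by their size `polyCells l ≤ 8 * l ^ (l + 1)`. For `l ≥ 2` the
factor `4 ^ l * (l + 1) ^ 4 ≤ 64 ^ l` is at most `64 ^ 64 * (M + l) ^ (l - 2)`, so everything is
below a constant times `N * (M + l) ^ (3 * l)` (`taylorTime_le`). The remaining factors of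
`costBound`, including the exponential, are used only through being at least `1`. Over the whole run
the costs are amortized (`Amort`). Each Taylor step pays for the tests around it. Each round does at
least one Blahut-Arimoto iteration, which pays for the reduction, the truncation and the next
support test. The grid point counted beyond the Taylor steps pays for loading the polynomials and
for the first test.

Memory. Here the leading terms must be sharp. Tensors of order `l ≥ 2` are not memorized, so the
stored ones have at most `M ^ l` entries, and the geometric sum over the number of `β`-derivatives
gives `O(M ^ l)` per order up to lower terms. The polynomials have at most `2 ^ k * k!` monomials,
whence the term `l ^ (l + 5 / 2) * ln l`. For `l = 1` the Jacobian takes `M ^ 2` cells, which the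
bound does not contain. It is rescued by `IsNonsingularRoot.card_support_le`: if the support had
more than `N` letters, some direction would leave all partition functions unchanged, and the
Jacobian would vanish on it. Since the first round reduces to the support, the working size is then
at most `N` (`peak_trackRounds_le`). -/

namespace RDTracking

/-! ### A calculus of time and memory bounds -/

/-- The run from `s` to `s'` takes at most `T` operations and `K` additional cells, releases the
cells it takes, and does `a` Taylor steps and `b` Blahut-Arimoto iterations. -/
structure Bounded (a b T K : ℕ) (s s' : Machine) : Prop where
  time : s'.time ≤ s.time + T
  brk : s'.brk = s.brk
  peak : s'.peak ≤ max s.peak (s.brk + K)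
  taylor : s'.taylorSteps = s.taylorSteps + a
  ba : s'.baIters = s.baIters + b

/-- The first run restores `brk`, so the second starts at the same stack height; this is why the
cells combine by `max` and not by a sum. -/
theorem Bounded.trans {a b T K a' b' T' K' : ℕ} {s s' s'' : Machine} (h : Bounded a b T K s s')
    (h' : Bounded a' b' T' K' s' s'') :
    Bounded (a + a') (b + b') (T + T') (max K K') s s'' where
  time := by have := h.time; have := h'.time; omega
  brk := by rw [h'.brk, h.brk]
  peak := by have := h.peak; have := h'.peak; have := h.brk; omega
  taylor := by have := h.taylor; have := h'.taylor; omega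
  ba := by have := h.ba; have := h'.ba; omega

theorem Bounded.mono {a b T K T' K' : ℕ} {s s' : Machine} (h : Bounded a b T K s s')
    (hT : T ≤ T') (hK : K ≤ K') : Bounded a b T' K' s s' where
  time := by have := h.time; omega
  brk := h.brk
  peak := by have := h.peak; omega
  taylor := h.taylor
  ba := h.ba

theorem Bounded.refl (s : Machine) : Bounded 0 0 0 0 s s :=
  ⟨le_rfl, rfl, le_max_left _ _, rfl, rfl⟩

/-- Every run of `P` takes at most `T` operations and `K` additional cells, and does `a` Taylor
steps and `b` Blahut-Arimoto iterations. -/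
structure Cost {α : Type} (a b : ℕ) (P : Prog α) (T K : ℕ) : Prop where
  run : ∀ s, Bounded a b T K s (P.run s).2

/-- Every result of `P` satisfies `Q`. -/
def Returns {α : Type} (P : Prog α) (Q : α → Prop) : Prop := ∀ s, Q (P.run s).1

namespace Cost

variable {α β : Type} {a b T K T' K' : ℕ}

theorem mono {P : Prog α} (h : Cost a b P T K) (hT : T ≤ T') (hK : K ≤ K') : Cost a b P T' K' :=
  ⟨fun s => (h.run s).mono hT hK⟩

theorem pure (v : α) : Cost 0 0 (pure v : Prog α) 0 0 := ⟨fun s => Bounded.refl s⟩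

/-- Values computed by `P` may control the length of later loops, so a bound for the continuation
can depend on what is known about them; `Q` carries this knowledge. -/
theorem bindAux {a' b' : ℕ} {P : Prog α} {f : α → Prog β} {Q : α → Prop} (hQ : Returns P Q)
    (h : Cost a b P T K) (hf : ∀ v, Q v → Cost a' b' (f v) T' K') :
    Cost (a + a') (b + b') (P >>= f) (T + T') (max K K') :=
  ⟨fun s => (h.run s).trans ((hf _ (hQ s)).run _)⟩

theorem bindQ {P : Prog α} {f : α → Prog β} {Q : α → Prop} (hQ : Returns P Q)
    (h : Cost 0 0 P T K) (hf : ∀ v, Q v → Cost a b (f v) T' K') :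
    Cost a b (P >>= f) (T + T') (max K K') := by
  simpa using bindAux hQ h hf

theorem bind {P : Prog α} {f : α → Prog β} (h : Cost 0 0 P T K)
    (hf : ∀ v, Cost a b (f v) T' K') : Cost a b (P >>= f) (T + T') (max K K') :=
  bindQ (Q := fun _ => True) (fun _ => trivial) h fun v _ => hf v

theorem tick (n : ℕ) : Cost 0 0 (tick n) n 0 :=
  ⟨fun _ => ⟨le_rfl, rfl, le_max_left _ _, rfl, rfl⟩⟩

theorem op (v : α) : Cost 0 0 (do RDTracking.tick 1; Pure.pure v) 1 0 :=
  ⟨fun _ => ⟨le_rfl, rfl, le_max_left _ _, rfl, rfl⟩⟩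

theorem readCell (i : ℕ) : Cost 0 0 (readCell i) 1 0 :=
  ⟨fun _ => ⟨le_rfl, rfl, le_max_left _ _, rfl, rfl⟩⟩

theorem writeCell (i : ℕ) (v : ℝ) : Cost 0 0 (writeCell i v) 1 0 :=
  ⟨fun _ => ⟨le_rfl, rfl, le_max_left _ _, rfl, rfl⟩⟩

theorem emit (v : ℝ) : Cost 0 0 (emit v) 1 0 :=
  ⟨fun _ => ⟨le_rfl, rfl, le_max_left _ _, rfl, rfl⟩⟩

theorem ite {c : Prop} [Decidable c] {P P' : Prog α} (h : Cost a b P T K) (h' : Cost a b P' T' K') :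
    Cost a b (if c then P else P') (T + T') (max K K') := by
  split
  · exact h.mono (by omega) (by omega)
  · exact h'.mono (by omega) (by omega)

theorem withCells {n : ℕ} {f : ℕ → Prog α} (h : ∀ base, Cost a b (f base) T K) :
    Cost a b (withCells n f) (n + T) (n + K) := by
  refine ⟨fun s => ?_⟩
  have := (h s.brk).run { s with
    brk := s.brk + n
    peak := max s.peak (s.brk + n)
    time := s.time + n
    mem := fun i => if s.brk ≤ i ∧ i < s.brk + n then 0 else s.mem i }
  obtain ⟨h1, h2, h3, h4, h5⟩ := this
  refine ⟨?_, rfl, ?_, h4, h5⟩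
  · exact h1.trans (by simp; omega)
  · exact h3.trans (by simp; omega)

theorem loop {n : ℕ} {f : ℕ → Prog Unit} (h : ∀ i < n, Cost 0 0 (f i) T K) :
    Cost 0 0 (loop n f) (n * (T + 1)) K := by
  induction n with
  | zero => exact (pure ()).mono (by simp) (by simp)
  | succ n ih =>
    refine ((ih fun i hi => h i (by omega)).bind fun _ => (tick 1).bind fun _ =>
      h n (by omega)).mono ?_ ?_
    · rw [Nat.succ_mul]; omega
    · omega

theorem sumLoop {n : ℕ} {f : ℕ → Prog ℝ} (h : ∀ i < n, Cost 0 0 (f i) T K) :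
    Cost 0 0 (sumLoop n f) (n * (T + 1) + 1) K := by
  induction n with
  | zero => exact (op _).mono (by simp) (by simp)
  | succ n ih =>
    refine ((ih fun i hi => h i (by omega)).bind fun _ => (h n (by omega)).bind fun _ =>
      op _).mono ?_ ?_
    · rw [Nat.succ_mul]; omega
    · omega

theorem prodLoop {n : ℕ} {f : ℕ → Prog ℝ} (h : ∀ i < n, Cost 0 0 (f i) T K) :
    Cost 0 0 (prodLoop n f) (n * (T + 1) + 1) K := by
  induction n with
  | zero => exact (op _).mono (by simp) (by simp)
  | succ n ih =>
    refine ((ih fun i hi => h i (by omega)).bind fun _ => (h n (by omega)).bind fun _ =>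
      op _).mono ?_ ?_
    · rw [Nat.succ_mul]; omega
    · omega

theorem rpowNat (x : ℝ) {n m : ℕ} (h : n ≤ m) : Cost 0 0 (rpowNat x n) (m + 1) 0 :=
  (prodLoop fun _ _ => pure x).mono (by omega) le_rfl

theorem listSum (t : List ℕ) : Cost 0 0 (listSum t) (2 * t.length + 1) 0 := by
  induction t with
  | nil => exact op _
  | cons x t ih =>
    refine (ih.bind fun _ => op _).mono ?_ ?_
    · simp only [List.length_cons]; omega
    · simp

end Cost

theorem returns_listSum (t : List ℕ) : Returns (listSum t) (· = t.sum) := by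
  induction t with
  | nil => intro s; rfl
  | cons x t ih =>
    intro s
    rw [List.sum_cons, ← ih s]
    rfl

theorem getD_le_sum (t : List ℕ) (i : ℕ) : t.getD i 0 ≤ t.sum := by
  by_cases h : i < t.length
  · rw [List.getD_eq_getElem _ _ h]
    exact List.le_sum_of_mem (List.getElem_mem h)
  · rw [List.getD_eq_default _ _ (not_lt.1 h)]; exact Nat.zero_le _

theorem returns_idx (t : List ℕ) (i : ℕ) : Returns (idx t i) (· ≤ t.sum) :=
  fun _ => getD_le_sum t i

/-! ### Initial computations at a grid point -/

namespace Cost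

theorem computeFactorials (c : Ctx) : Cost 0 0 (computeFactorials c) (8 * (c.l + 1)) 0 := by
  unfold RDTracking.computeFactorials
  -- The bounds of the composed program are left as metavariables and are synthesized by the
  -- combinators along the code; only their comparison with the stated ones remains.
  apply mono
  case h =>
    repeat' first
      | intro _ | exact op _ | apply readCell | apply writeCell | apply loop | apply bind
  case hT => omega
  case hK => simp

theorem computeEncoder (c : Ctx) (β : ℝ) (hN : 1 ≤ c.N) :
    Cost 0 0 (computeEncoder c β) (30 * ((c.M + 1) * c.N)) 0 := by
  unfold RDTracking.computeEncoder
  apply mono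
  case h =>
    repeat' first
      | intro _ | exact op _ | apply readCell | apply writeCell | apply loop | apply sumLoop
      | apply bind
  case hT =>
    have := Nat.le_mul_of_pos_right c.M hN
    ring_nf
    linarith
  case hK => simp

theorem computeExpectations (c : Ctx) (hN : 1 ≤ c.N) :
    Cost 0 0 (computeExpectations c) (40 * ((c.l + 1) * ((c.M + 1) * c.N))) (c.M * c.N) := by
  unfold RDTracking.computeExpectations
  apply mono
  case h =>
    repeat' first
      | intro _ | exact op _ | apply readCell | apply writeCell | apply loop | apply sumLoop
      | apply withCells | apply bind
  case hT =>
    have h1 := Nat.le_mul_of_pos_right c.M hN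
    have h2 := Nat.mul_le_mul_left c.l h1
    have h3 := Nat.mul_le_mul_left c.l hN
    ring_nf at h2 h3 ⊢
    omega
  case hK => simp

theorem evalWord (c : Ctx) (i x : ℕ) (w : List ℕ) :
    Cost 0 0 (evalWord c i x w) (2 * w.length + 1) 0 := by
  induction w with
  | nil => exact op _
  | cons v w ih =>
    refine ((readCell _).bind fun _ => ih.bind fun _ => op _).mono ?_ (by simp)
    simp only [List.length_cons]
    omega

theorem evalPoly (c : Ctx) (i x : ℕ) (us : List (Bool × List ℕ)) :
    Cost 0 0 (evalPoly c i x us) (3 * (us.map fun u => 1 + u.2.length).sum + 1) 0 := by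
  induction us with
  | nil => exact op _
  | cons u us ih =>
    refine (ih.bind fun _ => (evalWord c i x u.2).bind fun _ => ite (op _) (op _)).mono ?_
      (by simp)
    simp only [List.map_cons, List.sum_cons]
    omega

theorem computeP (c : Ctx) (hN : 1 ≤ c.N) :
    Cost 0 0 (computeP c) ((c.l + 1) * ((c.M + 1) * c.N) * (3 * polyCells c.l + 5)) 0 := by
  have h (k : ℕ) (hk : k < c.l + 1) :
      ((polyP k).map fun u => 1 + u.2.length).sum ≤ polyCells c.l :=
    Finset.single_le_sum (f := fun k => ((polyP k).map fun u => 1 + u.2.length).sum)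
      (fun _ _ => Nat.zero_le _) (Finset.mem_range.2 hk)
  refine (loop (T := c.M * (c.N * (3 * polyCells c.l + 3) + 1)) (K := 0) fun k hk =>
    (loop fun i _ => (loop fun x _ => ((evalPoly c i x _).mono
      (T' := 3 * polyCells c.l + 1) ?_ le_rfl).bind fun _ => writeCell _ _).mono
        le_rfl (by simp)).mono (by ring_nf; rfl) le_rfl).mono ?_ le_rfl
  · have := h k hk
    omega
  · rw [mul_assoc]
    refine Nat.mul_le_mul_left _ ?_
    have := Nat.le_mul_of_pos_right c.M hN
    nlinarith [Nat.zero_le (c.N * polyCells c.l)]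

/-! ### Enumerations of multi-indices, partitions and index tuples -/

theorem loopSum {n : ℕ} {f : ℕ → Prog Unit} {T : ℕ → ℕ} (h : ∀ i < n, Cost 0 0 (f i) (T i) K) :
    Cost 0 0 (RDTracking.loop n f) (∑ i ∈ Finset.range n, (T i + 1)) K := by
  induction n with
  | zero => exact (pure ()).mono (by simp) (by simp)
  | succ n ih =>
    refine ((ih fun i hi => h i (by omega)).bind fun _ => (RDTracking.Cost.tick 1).bind fun _ =>
      h n (by omega)).mono ?_ ?_
    · rw [Finset.sum_range_succ]; omega
    · omega

/-- The right side expands into the same powers with binomial coefficients, each at least `1`. -/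
theorem _root_.Nat.sum_range_pow_le_succ_pow (x n : ℕ) :
    ∑ i ∈ Finset.range (n + 1), x ^ i ≤ (x + 1) ^ n := by
  induction n with
  | zero => simp
  | succ n ih =>
    rw [Finset.sum_range_succ, pow_succ (x + 1), pow_succ x]
    have := Nat.pow_le_pow_left (Nat.le_succ x) n
    nlinarith

/-- Fixing one entry `a` leaves weight `rem - a` for the others, so the count obeys a geometric sum,
which raises the base by one per level. The overhead of a level, two operations per branch, is
charged to the leaves, as every branch bound is at least `1`. -/
theorem forComps {n rem : ℕ} {acc : List ℕ} {body : List ℕ → Prog Unit}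
    (h : ∀ α : List ℕ, α.sum = rem + acc.sum → Cost 0 0 (body α) T K) :
    Cost 0 0 (forComps n rem acc body) ((n + 1) ^ rem * (T + 2 * n + 1)) (n + K) := by
  induction n using Nat.twoStepInduction generalizing rem acc with
  | zero =>
    by_cases hr : rem = 0
    · subst hr
      exact ((tick 1).bind fun _ => (h acc (by simp))).mono (by simp; omega) (by simp)
    · exact ((tick 1).bind fun _ => (by rw [if_neg hr]; exact pure ())).mono (by simp) (by simp)
  | one =>
    refine (withCells fun _ => (tick 1).bind fun _ => h (rem :: acc) (by simp)).mono ?_ (by simp)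
    have := Nat.one_le_two_pow (n := rem)
    rw [one_add_one_eq_two]
    nlinarith
  | more n _ ih =>
    refine (loopSum (K := n + 2 + K)
      (T := fun a => 1 + (n + 2) ^ (rem - a) * (T + 2 * (n + 1) + 1)) fun a ha =>
      (withCells fun _ => (ih (rem := rem - a) (acc := a :: acc) fun α hα => h α ?_)).mono
        le_rfl (by omega)).mono ?_ le_rfl
    · rw [hα, List.sum_cons]; omega
    · calc ∑ a ∈ Finset.range (rem + 1), (1 + (n + 2) ^ (rem - a) * (T + 2 * (n + 1) + 1) + 1)
          ≤ ∑ a ∈ Finset.range (rem + 1), (n + 2) ^ (rem - a) * (T + 2 * (n + 2) + 1) := by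
            refine Finset.sum_le_sum fun a _ => ?_
            have := Nat.one_le_pow (rem - a) (n + 2) (by omega)
            nlinarith
        _ ≤ _ := by
            rw [← Finset.sum_mul]
            refine Nat.mul_le_mul_right _ ?_
            have := Finset.sum_range_reflect (fun i => (n + 2) ^ i) (rem + 1)
            simp only [Nat.add_sub_cancel] at this
            rw [this]
            exact Nat.sum_range_pow_le_succ_pow _ _

/-- A geometric sum with ratio at most `1 / 2`. Counting the last term twice makes the induction
close. -/
theorem _root_.Nat.sum_range_two_pow_sub_mul_le (n j : ℕ) (hj : 1 ≤ j) (m : ℕ) (h : m * j ≤ n) :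
    ∑ c ∈ Finset.range (m + 1), 2 ^ (n - c * j) + 2 ^ (n - m * j) ≤ 2 * 2 ^ n := by
  induction m with
  | zero => simp; omega
  | succ m ih =>
    rw [Finset.sum_range_succ]
    have h1 := ih (by nlinarith)
    have h2 : 2 * 2 ^ (n - (m + 1) * j) ≤ 2 ^ (n - m * j) := by
      rw [← pow_succ']
      refine Nat.pow_le_pow_right (by norm_num) ?_
      rw [Nat.succ_mul] at h ⊢
      omega
    omega

/-- Choosing a multiplicity `c` of a part lowers `rem` by a multiple of it; weighted by `2 ^ rem`,
all choices together cost a factor of at most `2` per level. With `j = rem = k` this gives `4 ^ k`,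
far from the true number of partitions but sufficient. The bound on `t.sum` is the fact that the
number of parts does not exceed the partitioned number. -/
theorem forParts {j rem : ℕ} {acc : List ℕ} {body : List ℕ → Prog Unit}
    (h : ∀ t : List ℕ, t.length = j + acc.length → t.sum ≤ rem + acc.sum →
      Cost 0 0 (body t) T K) :
    Cost 0 0 (forParts j rem acc body) (2 ^ (rem + j) * (T + 2 * j + 1)) (j + K) := by
  induction j using Nat.twoStepInduction generalizing rem acc with
  | zero =>
    refine ((tick 1).bind fun _ => ite (h acc (by simp) (by simp)) (pure ())).mono ?_ (by simp)
    have := Nat.one_le_two_pow (n := rem)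
    simp only [add_zero, mul_zero]
    nlinarith
  | one =>
    refine (withCells fun _ => (tick 1).bind fun _ => h (rem :: acc) (by simp [add_comm])
      (by simp)).mono ?_ (by simp)
    have := Nat.one_le_two_pow (n := rem + 1)
    nlinarith
  | more j _ ih =>
    refine (loopSum (K := j + 2 + K)
      (T := fun c => 1 + 2 ^ (rem - c * (j + 2) + (j + 1)) * (T + 2 * (j + 1) + 1)) fun c hc =>
      (withCells fun _ => (ih (rem := rem - c * (j + 2)) (acc := c :: acc)
        fun t ht ht' => h t ?_ ?_)).mono le_rfl (by omega)).mono ?_ le_rfl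
    · rw [ht, List.length_cons]; omega
    · rw [List.sum_cons] at ht'
      have h1 : c * (j + 2) ≤ rem := (Nat.le_div_iff_mul_le (by omega)).1 (by omega)
      have h2 : c ≤ c * (j + 2) := Nat.le_mul_of_pos_right _ (by omega)
      omega
    · calc ∑ c ∈ Finset.range (rem / (j + 2) + 1),
            (1 + 2 ^ (rem - c * (j + 2) + (j + 1)) * (T + 2 * (j + 1) + 1) + 1)
          ≤ ∑ c ∈ Finset.range (rem / (j + 2) + 1),
            2 ^ (rem - c * (j + 2)) * (2 ^ (j + 1) * (T + 2 * (j + 2) + 1)) := by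
            refine Finset.sum_le_sum fun c _ => ?_
            rw [← mul_assoc, ← pow_add]
            have := Nat.one_le_two_pow (n := rem - c * (j + 2) + (j + 1))
            nlinarith
        _ ≤ _ := by
            rw [← Finset.sum_mul, ← mul_assoc]
            refine Nat.mul_le_mul_right _ ?_
            have := Nat.sum_range_two_pow_sub_mul_le rem (j + 2) (by omega) _
              (Nat.div_mul_le_self _ _)
            refine (Nat.mul_le_mul_right _ ((Nat.le_add_right _ _).trans this)).trans_eq ?_
            ring

/-- All index tuples are charged, whether or not they have the multiplicities `α`. The `7` collects
the loop step, the lookup, the cell and the index arithmetic of a level. -/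
theorem forArrangements {M t : ℕ} {α : List ℕ} {off : ℕ} {body : ℕ → Prog Unit}
    (h : ∀ off, Cost 0 0 (body off) T K) :
    Cost 0 0 (forArrangements M t α off body) ((M + 1) ^ t * (T + 7 * t)) (t + K) := by
  induction t generalizing α off with
  | zero => exact (h off).mono (by simp) (by simp)
  | succ t ih =>
    refine (loop fun i _ => (op _).bind fun _ => ite (pure ()) (withCells fun _ =>
      (tick 4).bind fun _ => ih)).mono ?_ (by omega)
    have := Nat.one_le_pow t (M + 1) (by omega)
    rw [pow_succ]
    nlinarith [Nat.zero_le (M * ((M + 1) ^ t - 1)), Nat.zero_le ((M + 1) ^ t * (T + 7 * t)),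
      Nat.mul_le_mul_left M this]

theorem computeG (c : Ctx) (hN : 1 ≤ c.N) :
    Cost 0 0 (computeG c) (60 * (4 ^ c.l * (c.l + 1) ^ 3 * ((c.M + 1) * c.N))) (c.l + 1) := by
  have key (k : ℕ) (hk : k < c.l + 1) :
      Cost 0 0 (RDTracking.forParts k k [] fun t => do
        let m ← RDTracking.listSum t
        RDTracking.loop c.M fun i => RDTracking.loop c.N fun x => do
          let w ← RDTracking.prodLoop k fun j => do
            let tj ← idx t j
            let y ← RDTracking.readCell (c.aPk + ((j + 1) * c.M + i) * c.N + x)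
            let z ← rdiv y (← RDTracking.readCell (c.aF + (j + 1)))
            let u ← RDTracking.rpowNat z tj
            rdiv u (← RDTracking.readCell (c.aF + tj))
          let invf ← lit 1
          RDTracking.withCells 1 fun cell => do
            RDTracking.writeCell cell invf
            RDTracking.loop (c.l + 2 - m) fun e => do
              let f ← RDTracking.readCell cell
              let g ← RDTracking.readCell
                (c.aG + ((k * (c.l + 2) + (m + e)) * c.M + i) * c.N + x)
              let g' ← radd g (← rmul w f)
              RDTracking.writeCell (c.aG + ((k * (c.l + 2) + (m + e)) * c.M + i) * c.N + x) g'
              let f' ← rdiv f (← lit (e + 1))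
              RDTracking.writeCell cell f')
        (4 ^ c.l * (2 * c.l + 1 + c.M * (c.N * (c.l * (c.l + 8) + 20 + 9 * (c.l + 2)) + 1)
          + (2 * c.l + 1))) (c.l + 1) := by
    refine (forParts (T := 2 * c.l + 1 +
      c.M * (c.N * (c.l * (c.l + 8) + 20 + 9 * (c.l + 2)) + 1)) (K := 1) fun t ht ht' => ?_).mono
      ?_ ?_
    · simp only [List.length_nil, List.sum_nil, add_zero] at ht ht'
      refine ((listSum t).bind fun m => loop (T := c.N * (c.l * (c.l + 8) + 20 + 9 * (c.l + 2)))
        (K := 1) fun i _ => (loop (T := c.l * (c.l + 8) + 19 + 9 * (c.l + 2)) (K := 1)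
        fun x _ => ?_).mono (by ring_nf; rfl) le_rfl).mono (by omega) (by simp)
      refine ((prodLoop (T := c.l + 7) (K := 0) fun j _ => ?_).bind fun _ =>
        (op _).bind fun _ => withCells (T := 1 + (c.l + 2) * 9) (K := 0) fun _ => ?_).mono ?_ ?_
      · refine (bindQ (returns_idx t j) (op _) fun tj htj => (readCell _).bind fun _ =>
          (readCell _).bind fun _ => (op _).bind fun _ => (rpowNat _ (htj.trans (ht'.trans
            (Nat.lt_succ_iff.1 hk)))).bind fun _ => (readCell _).bind fun _ => op _).mono ?_ ?_
        · omega
        · simp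
      · apply mono
        case h =>
          repeat' first
            | intro _ | exact op _ | apply readCell | apply writeCell | apply loop | apply bind
        case hT =>
          have : (c.l + 2 - m) * 9 ≤ (c.l + 2) * 9 := Nat.mul_le_mul_right _ (Nat.sub_le _ _)
          omega
        case hK => simp
      · have : k * (c.l + 8) ≤ c.l * (c.l + 8) := Nat.mul_le_mul_right _ (by omega)
        simp only [show c.l + 7 + 1 = c.l + 8 from rfl]
        omega
      · simp
    · rw [← two_mul, pow_mul]
      exact Nat.mul_le_mul (Nat.pow_le_pow_right (by norm_num) (by omega)) (by omega)
    · omega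
  refine (loop key).mono ?_ le_rfl
  have h1 := Nat.le_mul_of_pos_right c.M hN
  have h2 := Nat.one_le_pow c.l 4 (by omega)
  have h3 : 2 * c.l + 1 + c.M * (c.N * (c.l * (c.l + 8) + 20 + 9 * (c.l + 2)) + 1) +
      (2 * c.l + 1) + 1 ≤ 60 * ((c.l + 1) ^ 2 * ((c.M + 1) * c.N)) := by
    have h4 := Nat.mul_le_mul_left c.l hN
    ring_nf at h1 h4 ⊢
    omega
  calc _ ≤ (c.l + 1) * (4 ^ c.l * (2 * c.l + 1 + c.M * (c.N * (c.l * (c.l + 8) + 20 +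
        9 * (c.l + 2)) + 1) + (2 * c.l + 1) + 1)) := by
        refine Nat.mul_le_mul_left _ ?_
        rw [Nat.mul_succ (4 ^ c.l)]
        exact Nat.add_le_add_left h2 _
    _ ≤ (c.l + 1) * (4 ^ c.l * (60 * ((c.l + 1) ^ 2 * ((c.M + 1) * c.N)))) := by gcongr
    _ = _ := by ring

/-! ### Derivative tensors and their evaluation -/

theorem calcBetaDeriv (c : Ctx) (b i : ℕ) (hN : 1 ≤ c.N) :
    Cost 0 0 (calcBetaDeriv c b i) (12 * c.N) 0 := by
  unfold RDTracking.calcBetaDeriv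
  apply mono
  case h =>
    repeat' first
      | intro _ | exact op _ | apply readCell | apply sumLoop | apply bind
  case hT => omega
  case hK => simp

theorem calcMixedDeriv (c : Ctx) (b t i : ℕ) {α : List ℕ} (hα : α.sum ≤ t) (hN : 1 ≤ c.N) :
    Cost 0 0 (calcMixedDeriv c b t α i) (100 * (c.N * ((t + 1) * (c.M + 1) ^ (b + 1))))
      (c.M + 1) := by
  unfold RDTracking.calcMixedDeriv
  have h1 (x : ℕ) : Cost 0 0 (RDTracking.prodLoop c.M fun j => do
      let aj ← idx α j
      let u ← rdiv (← RDTracking.readCell (c.aQ + j * c.N + x)) (← RDTracking.readCell (c.aR + j))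
      RDTracking.rpowNat u aj) (c.M * (t + 6) + 1) 0 :=
    prodLoop (T := t + 5) fun j _ => (bindQ (returns_idx α j) (op _) fun aj haj =>
      (readCell _).bind fun _ => (readCell _).bind fun _ => (op _).bind fun _ =>
      rpowNat _ (haj.trans hα)).mono (by omega) (by simp)
  apply mono
  case h =>
    repeat' first
      | intro _ | exact op _ | apply h1 | apply readCell | apply writeCell | apply prodLoop
      | apply sumLoop | apply forComps | apply withCells | apply ite | apply bind
  case hT =>
    have h2 := Nat.one_le_pow b (c.M + 1) (by omega)
    rw [pow_succ]
    generalize (c.M + 1) ^ b = P at *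
    -- Writing quantities that are at least `1` as `1 + n` and `1 + q` turns the claim into a
    -- comparison of polynomials with natural coefficients, which `omega` settles with the monomials
    -- as atoms.
    obtain ⟨n, hn⟩ := Nat.exists_eq_add_of_le hN
    obtain ⟨q, rfl⟩ := Nat.exists_eq_add_of_le h2
    rw [hn]
    ring_nf
    omega
  case hK => simp [add_comm]

/-- The exponent `2 * m` comes from copying: each of the at most `(M + 1) ^ (m - b)` multi-indices
is charged for all index tuples. The derivatives themselves need only the exponents `m - b` and `b +
1`, whose sum `m + 1` is at most `2 * m`. -/
theorem calcTensorRow (c : Ctx) {m b : ℕ} (i base : ℕ) (hm : 1 ≤ m) (hb : b ≤ m) (hN : 1 ≤ c.N) :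
    Cost 0 0 (calcTensorRow c m b i base) (200 * ((m + 1) * (c.N * (c.M + 1) ^ (2 * m))))
      (2 * c.M + 1 + m) := by
  have hP := Nat.one_le_pow (2 * m) (c.M + 1) (by omega)
  unfold RDTracking.calcTensorRow
  split
  · refine ((calcBetaDeriv c b i hN).bind fun _ => writeCell _ _).mono ?_ (by simp)
    have : c.N ≤ (m + 1) * (c.N * (c.M + 1) ^ (2 * m)) := by
      calc c.N = 1 * (c.N * 1) := by simp
        _ ≤ _ := by gcongr; omega
    omega
  · refine (forComps (K := c.M + 1 + m) fun α hα => ((calcMixedDeriv c b (m - b) i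
      (by simp [hα]) hN).bind fun v => forArrangements (T := 1) (K := 0)
      fun off => writeCell _ _).mono le_rfl (by omega)).mono ?_ (by omega)
    have h1 : (c.M + 1) ^ (m - b) * (c.M + 1) ^ (b + 1) ≤ (c.M + 1) ^ (2 * m) := by
      rw [← pow_add]
      exact Nat.pow_le_pow_right (by omega) (by omega)
    have h2 : (c.M + 1) ^ (m - b) * (c.M + 1) ^ (m - b) ≤ (c.M + 1) ^ (2 * m) := by
      rw [← pow_add]
      exact Nat.pow_le_pow_right (by omega) (by omega)
    have h3 : (c.M + 1) ^ (m - b) * (c.M + 1) ≤ (c.M + 1) ^ (2 * m) := by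
      rw [← pow_succ]
      exact Nat.pow_le_pow_right (by omega) (by omega)
    generalize (c.M + 1) ^ (2 * m) = P at *
    generalize (c.M + 1) ^ (m - b) = A at *
    generalize (c.M + 1) ^ (b + 1) = D at *
    have h4 : m - b ≤ m := Nat.sub_le _ _
    generalize m - b = t at *
    have h5 : P ≤ (m + 1) * (c.N * P) := by
      calc P = 1 * (1 * P) := by simp
        _ ≤ _ := by gcongr; omega
    calc _ = 100 * ((t + 1) * (c.N * (A * D))) + (7 * t + 1) * (A * A) + A * (2 * c.M + 1) := by
          ring
      _ ≤ 100 * ((m + 1) * (c.N * P)) + (7 * (m + 1)) * (1 * P) + 2 * P := by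
          refine Nat.add_le_add (Nat.add_le_add ?_ ?_) (by nlinarith)
          · gcongr
          · rw [one_mul]
            exact Nat.mul_le_mul (by omega) h2
      _ ≤ 100 * ((m + 1) * (c.N * P)) + (7 * (m + 1)) * (c.N * P) + 2 * P := by gcongr
      _ ≤ _ := by nlinarith

theorem evalForm (c : Ctx) (base : ℕ) (args : List ℕ) (off : ℕ) :
    Cost 0 0 (evalForm c base args off) (5 * ((args.length + 1) * (c.M + 1) ^ args.length))
      args.length := by
  induction args generalizing off with
  | nil => exact (readCell _).mono (by simp) (by simp)
  | cons k ks ih =>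
    refine (withCells fun _ => sumLoop fun i _ => (readCell _).bind fun _ =>
      (ih _).bind fun _ => op _).mono ?_ ?_
    · rw [List.length_cons, pow_succ]
      generalize ks.length = n
      have := Nat.one_le_pow n (c.M + 1) (by omega)
      generalize (c.M + 1) ^ n = P at *
      obtain ⟨q, rfl⟩ := Nat.exists_eq_add_of_le this
      ring_nf
      omega
    · rw [List.length_cons]
      omega

end Cost

/-- Cells for a tensor of the highest order, which is not memorized. -/
def scratchCells (M l : ℕ) : ℕ := if l = 1 then 0 else M ^ l + 1

namespace Cost

/-- Evaluating a stored tensor is cheaper than computing it, so the first appearance dominates the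
time. Scratch space is taken only when `m = k = l` and `l ≥ 2`. -/
theorem applyTensorRow (c : Ctx) {k m b : ℕ} (i : ℕ) {args : List ℕ} (hk : 1 ≤ k) (hkl : k ≤ c.l)
    (hm : m ≤ k) (hb : b ≤ m) (hargs : args.length ≤ m) (hN : 1 ≤ c.N) :
    Cost 0 0 (applyTensorRow c k m b i args)
      (300 * ((k + 1) ^ 2 * (c.N * (c.M + 1) ^ (2 * k))))
      (scratchCells c.M c.l + (2 * c.M + 1 + c.l)) := by
  have hP := Nat.one_le_pow (2 * k) (c.M + 1) (by omega)
  have hP' : (c.M + 1) ^ k ≤ c.N * (c.M + 1) ^ (2 * k) :=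
    (Nat.pow_le_pow_right (by omega) (by omega)).trans (Nat.le_mul_of_pos_left _ hN)
  have hE (base : ℕ) : Cost 0 0 (RDTracking.evalForm c base args 0)
      (5 * ((k + 1) * (c.M + 1) ^ k)) m :=
    (evalForm c base args 0).mono (by gcongr <;> omega) hargs
  have e1 : (m + 1) * (m + 1) ≤ (k + 1) ^ 2 * (c.N * (c.M + 1) ^ (2 * k)) := by
    calc (m + 1) * (m + 1) ≤ (k + 1) * (k + 1) := by gcongr
      _ = (k + 1) ^ 2 * (1 * 1) := by ring
      _ ≤ _ := by gcongr
  have e2 : 5 * ((k + 1) * (c.M + 1) ^ k) ≤ 5 * ((k + 1) ^ 2 * (c.N * (c.M + 1) ^ (2 * k))) := by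
    gcongr
    exact Nat.le_self_pow (by omega) _
  have e3 : 200 * ((k + 1) * (c.N * (c.M + 1) ^ (2 * k))) ≤
      200 * ((k + 1) ^ 2 * (c.N * (c.M + 1) ^ (2 * k))) := by
    gcongr
    exact Nat.le_self_pow (by omega) _
  unfold RDTracking.applyTensorRow
  dsimp only
  refine ((tick _).bind fun _ => ?_).mono (T := (m + 1) * (m + 1) +
    (205 * ((k + 1) ^ 2 * (c.N * (c.M + 1) ^ (2 * k))) + (c.M + 1) ^ k))
    (K := max 0 (scratchCells c.M c.l + (2 * c.M + 1 + c.l))) ?_ (by omega)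
  · split
    · subst m
      split
      · exact ((calcTensorRow c i _ hk hb hN).bind fun _ => hE _).mono (by omega) (by omega)
      · refine (withCells fun _ => (calcTensorRow c i _ hk hb hN).bind fun _ => hE _).mono ?_ ?_
        · have : c.M ^ (k - b) ≤ (c.M + 1) ^ k :=
            (Nat.pow_le_pow_left (by omega) _).trans (Nat.pow_le_pow_right (by omega) (by omega))
          omega
        · have hl : k = c.l := by omega
          have : c.M ^ (k - b) ≤ c.M ^ c.l + 1 := by
            -- For an empty alphabet `0 ^ 0 = 1` may exceed `0 ^ l`; the additional cell in
            -- `scratchCells` covers this.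
            rcases Nat.eq_zero_or_pos c.M with h | h
            · rw [h]
              exact (Nat.pow_le_pow_left (Nat.zero_le 1) _).trans (by simp)
            · exact (Nat.pow_le_pow_right h (Nat.sub_le _ _)).trans (by rw [← hl]; exact Nat.le_succ _)
          rw [scratchCells, if_neg (by omega)]
          omega
    · exact (hE _).mono (by omega) (by omega)
  · have e4 : (c.M + 1) ^ k ≤ (k + 1) ^ 2 * (c.N * (c.M + 1) ^ (2 * k)) :=
      hP'.trans (Nat.le_mul_of_pos_left _ (by positivity))
    omega

/-! ### Gaussian elimination -/

theorem findPivot (a M col row n : ℕ) : Cost 0 0 (findPivot a M col row n) (2 * n + 1) 0 := by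
  induction n generalizing row with
  | zero => exact op _
  | succ n ih =>
    refine ((readCell _).bind fun _ => (op _).bind fun _ => ite (ih _) (pure _)).mono ?_ (by simp)
    omega

theorem eliminate (a M n col row : ℕ) (acc : List (ℕ × ℕ)) :
    Cost 0 0 (eliminate a M n col row acc) (n * (30 * (M + 1) ^ 2)) 0 := by
  induction n generalizing col row acc with
  | zero => exact (pure _).mono (by simp) le_rfl
  | succ n ih =>
    refine ((findPivot a M col row (M - row)).bind (T' := n * (30 * (M + 1) ^ 2) +
      (5 * (M + 1) + 1 + 3 * (M + 1) + M * (6 * (M + 1) + 2) + 10 * M + 10)) (K' := 0)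
      fun piv => ?_).mono ?_ (by simp)
    · cases piv with
      | none => exact (ih _ _ _).mono (by omega) le_rfl
      | some i =>
        dsimp only
        apply mono
        case h =>
          repeat' first
            | intro _ | exact op _ | apply ih | apply pure | apply readCell | apply writeCell
            | apply loop | apply ite | apply bind
        case hT =>
          ring_nf
          omega
        case hK => simp
    · have : 2 * (M - row) ≤ 2 * M := by omega
      ring_nf
      omega

theorem writeSolution (a M dst : ℕ) (us : List (ℕ × ℕ)) :
    Cost 0 0 (writeSolution a M dst us) (2 * us.length) 0 := by
  induction us with
  | nil => exact pure _
  | cons u us ih =>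
    refine ((readCell _).bind fun _ => (writeCell _ _).bind fun _ => ih).mono ?_ (by simp)
    rw [List.length_cons]
    omega

end Cost

theorem Returns.bind {α β : Type} {P : Prog α} {f : α → Prog β} {Q : β → Prop}
    (h : ∀ v, Returns (f v) Q) : Returns (P >>= f) Q := fun s => h _ (P.run s).2

/-- Each column yields at most one pivot. This bounds the time of `writeSolution`. -/
theorem returns_eliminate (a M n col row : ℕ) (acc : List (ℕ × ℕ)) :
    Returns (eliminate a M n col row acc) (·.length ≤ acc.length + n) := by
  induction n generalizing col row acc with
  | zero => exact fun _ => le_rfl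
  | succ n ih =>
    refine Returns.bind fun piv => ?_
    cases piv with
    | none => exact fun s => (ih _ _ _ s).trans (by omega)
    | some i =>
      refine Returns.bind fun _ => Returns.bind fun _ => Returns.bind fun _ => Returns.bind fun _ =>
        fun s => (ih _ _ _ s).trans ?_
      rw [List.length_cons]
      omega

namespace Cost

theorem solveLinear (M mat rhs dst : ℕ) :
    Cost 0 0 (solveLinear M mat rhs dst) (60 * (M + 1) ^ 3) (M * (M + 1) + 2 * M) := by
  unfold RDTracking.solveLinear
  refine (withCells (T := 2 * M + (M * (3 * M + 4) + M * 3 + M * (30 * (M + 1) ^ 2) + 2 * M))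
    (K := 2 * M) fun a => (withCells (K := 0) fun _ => ?_).mono le_rfl (by omega)).mono ?_ le_rfl
  · apply mono
    case h =>
      refine bind (loop (T := M * 3 + 2) (K := 0) fun _ _ => ?_) fun _ =>
        bind (loop (T := 2) (K := 0) fun _ _ => ?_) fun _ =>
        bindQ (returns_eliminate _ _ _ _ _ _) (eliminate _ _ _ _ _ _) fun us hus =>
        (writeSolution _ _ _ us).mono (T' := 2 * M) (by simp at hus; omega) le_rfl
      · exact ((loop fun _ _ => (readCell _).bind fun _ => writeCell _ _).bind fun _ =>
          (readCell _).bind fun _ => writeCell _ _).mono le_rfl (by simp)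
      · exact ((op _).bind fun _ => writeCell _ _).mono le_rfl (by simp)
    case hT =>
      ring_nf
      omega
    case hK => simp
  · ring_nf
    omega

/-! ### Implicit derivatives and the Taylor step -/

theorem partitionCoef (c : Ctx) (k b : ℕ) {t : List ℕ} (ht : t.sum ≤ k) :
    Cost 0 0 (partitionCoef c k b t) (20 * (k + 1) ^ 2) 0 := by
  unfold RDTracking.partitionCoef
  dsimp only
  have h (j : ℕ) {tj : ℕ} (htj : tj ≤ t.sum) (u : ℝ) : Cost 0 0 (do
      let v ← RDTracking.rpowNat (← RDTracking.readCell (c.aF + (j + 1))) tj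
      rmul u v) (k + 3) 0 :=
    ((readCell _).bind fun _ => (rpowNat _ (htj.trans ht)).bind fun _ => op _).mono (by omega)
      (by simp)
  refine ((prodLoop (T := 2 * k + 12) (K := 0) fun j _ => (bindQ (returns_idx t j) (op _)
    fun tj htj => ite ((readCell _).bind fun _ => (readCell _).bind fun _ => (op _).bind fun _ =>
    h j htj _) ((readCell _).bind fun _ => h j htj _)).mono (by omega) (by simp)).bind fun _ =>
    (readCell _).bind fun _ => op _).mono ?_ (by simp)
  ring_nf
  omega

end Cost
theorem length_formArgs_le (b : ℕ) (t : List ℕ) : (formArgs b t).length ≤ t.sum := by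
  have h : t.sum = ((List.range t.length).map fun j => t.getD j 0).sum := by
    conv_lhs => rw [← List.map_id t]
    congr 1
    refine List.ext_getElem (by simp) fun i h1 h2 => ?_
    simp at h1 ⊢
    simp [h1]
  rw [h, formArgs, List.length_flatMap]
  refine List.sum_le_sum fun j _ => ?_
  rw [List.length_replicate]
  split <;> omega

namespace Cost

variable {a b T K : ℕ}

/-- There are at most `4 ^ k` partitions, `k + 1` values of `b` and `M` rows for each. The `3 * l`
cells hold the partition, the list of orders, and the indices used inside a row. -/
theorem implicitDeriv (c : Ctx) {k : ℕ} (hk : 1 ≤ k) (hkl : k ≤ c.l) (hN : 1 ≤ c.N) :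
    Cost 0 0 (implicitDeriv c k) (1200 * (4 ^ k * (k + 1) ^ 3 * (c.N * (c.M + 1) ^ (2 * k + 1))))
      (scratchCells c.M c.l + c.M * (c.M + 1) + 5 * c.M + 1 + 3 * c.l) := by
  have hP := Nat.one_le_pow (2 * k) (c.M + 1) (by omega)
  have hF := Nat.one_le_pow k 4 (by omega)
  have hY : (k + 1) ^ 2 ≤ (k + 1) ^ 2 * (c.N * (c.M + 1) ^ (2 * k)) :=
    Nat.le_mul_of_pos_right _ (by positivity)
  set Y := (k + 1) ^ 2 * (c.N * (c.M + 1) ^ (2 * k)) with hYdef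
  have hbody (res : ℕ) : Cost 0 0 (RDTracking.forParts k k [] fun t => do
      let m ← RDTracking.listSum t
      let m1 ← idx t 0
      RDTracking.loop (m1 + 1) fun b =>
        if m = 1 ∧ b = 0 then Pure.pure () else do
          let coef ← RDTracking.partitionCoef c k b t
          RDTracking.withCells m fun _ => do
            RDTracking.tick (k + m)
            RDTracking.loop c.M fun i => do
              let v ← RDTracking.applyTensorRow c k m b i (formArgs b t)
              let y ← rsub (← RDTracking.readCell (res + i)) (← rmul coef v)
              RDTracking.writeCell (res + i) y)
      (4 ^ k * (400 * (k + 1) * ((c.M + 1) * Y)))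
      (scratchCells c.M c.l + (2 * c.M + 1) + 3 * c.l) := by
    refine (forParts (T := 2 * k + 2 + (k + 1) * (20 * (k + 1) ^ 2 + 3 * k + c.M * (300 * Y + 5) + 1))
      (K := scratchCells c.M c.l + (2 * c.M + 1 + c.l) + c.l) fun t ht ht' => ?_).mono ?_ ?_
    · simp only [List.length_nil, List.sum_nil, add_zero] at ht ht'
      refine (bindQ (returns_listSum t) (listSum t) fun m hm => bindQ (returns_idx t 0) (op _)
        fun m1 hm1 => (loop (T := 20 * (k + 1) ^ 2 + 3 * k + c.M * (300 * Y + 5))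
        (K := scratchCells c.M c.l + (2 * c.M + 1 + c.l) + c.l) fun b hb => ?_).mono
          (T' := (k + 1) * (20 * (k + 1) ^ 2 + 3 * k + c.M * (300 * Y + 5) + 1))
          (Nat.mul_le_mul_right _ (by omega)) le_rfl).mono ?_ (by omega)
      · split
        · exact (pure ()).mono (by omega) (by omega)
        · have hlen := length_formArgs_le b t
          subst hm
          refine ((partitionCoef c k b ht').bind fun coef => withCells fun _ => (tick _).bind
            fun _ => loop fun i _ => (applyTensorRow c i hk hkl ht' (by omega) hlen
            hN).bind fun v => (readCell _).bind fun _ => (op _).bind fun _ => (op _).bind fun _ =>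
            writeCell _ _).mono ?_ ?_
          · have : c.M * (Y * 300 + 5) = c.M * (300 * Y + 5) := by ring
            rw [← hYdef]
            simp only [Nat.add_assoc, Nat.reduceAdd] at this ⊢
            omega
          · omega
      · omega
    · rw [← two_mul, pow_mul]
      refine Nat.mul_le_mul_left _ ?_
      -- Since `Y` exceeds `(k + 1) ^ 2`, the terms without `Y` are absorbed once `Y` is written as
      -- `(k + 1) ^ 2 + Z`.
      obtain ⟨Z, hZ⟩ := Nat.exists_eq_add_of_le hY
      rw [hZ]
      ring_nf
      omega
    · omega
  have hrow (i : ℕ) : Cost 0 0 (RDTracking.calcTensorRow c 1 0 i (c.aT + i * c.M))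
      (200 * Y) (2 * c.M + 2) := by
    refine (calcTensorRow c i _ le_rfl (by omega) hN).mono ?_ le_rfl
    rw [hYdef]
    have : 1 + 1 ≤ (k + 1) ^ 2 := by nlinarith
    gcongr
    omega
  have hsolve : 60 * (c.M + 1) ^ 3 ≤ 60 * ((c.M + 1) * Y) := by
    have : (c.M + 1) ^ 3 = (c.M + 1) * (1 * (1 * (c.M + 1) ^ (2 * 1))) := by ring
    rw [this, hYdef]
    gcongr
    · exact Nat.one_le_pow _ _ (by omega)
    · omega
  unfold RDTracking.implicitDeriv
  dsimp only
  refine (withCells fun res => (hbody res).bind fun _ => ite ((loop fun i _ => hrow i).bind fun _ =>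
    solveLinear _ _ _ _) (solveLinear _ _ _ _)).mono ?_ ?_
  · have h1 : 1 ≤ Y := le_trans (by nlinarith) hY
    calc _ ≤ 4 ^ k * (400 * (k + 1) * ((c.M + 1) * Y)) + 1 * (322 * (1 * ((c.M + 1) * Y))) := by
          nlinarith
      _ ≤ 4 ^ k * (400 * (k + 1) * ((c.M + 1) * Y)) + 4 ^ k * (322 * ((k + 1) * ((c.M + 1) * Y))) := by
          gcongr; omega
      _ = 722 * (4 ^ k * (k + 1) * ((c.M + 1) * Y)) := by ring
      _ ≤ 1200 * (4 ^ k * (k + 1) * ((c.M + 1) * Y)) := by gcongr; omega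
      _ = _ := by rw [hYdef]; ring
  · omega

end Cost

/-- A crude bound that serves for the time of initializing the cells; the memory bound needs the
sharper `orderCells_le`. -/
theorem tensorCells_le (M : ℕ) {l : ℕ} (hl : 1 ≤ l) :
    tensorCells M l ≤ (l + 1) ^ 2 * (M + 1) ^ (l + 1) := by
  have h1 (m : ℕ) (hm : m ∈ Finset.Icc 1 (max 1 (l - 1))) :
      orderCells M m ≤ (l + 1) * (M + 1) ^ (l + 1) := by
    rw [Finset.mem_Icc] at hm
    calc orderCells M m ≤ ∑ b ∈ Finset.range (m + 1), (M + 1) ^ (l + 1) :=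
          Finset.sum_le_sum fun b _ => (Nat.pow_le_pow_left (by omega) _).trans
            (Nat.pow_le_pow_right (by omega) (by omega))
      _ = (m + 1) * (M + 1) ^ (l + 1) := by simp
      _ ≤ _ := by gcongr; omega
  calc tensorCells M l ≤ ∑ m ∈ Finset.Icc 1 (max 1 (l - 1)), (l + 1) * (M + 1) ^ (l + 1) :=
        Finset.sum_le_sum h1
    _ = max 1 (l - 1) * ((l + 1) * (M + 1) ^ (l + 1)) := by simp
    _ ≤ (l + 1) * ((l + 1) * (M + 1) ^ (l + 1)) := by gcongr; omega
    _ = _ := by ring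

/-- A bound on the number of operations of a Taylor step. -/
def taylorTime (l M N : ℕ) : ℕ :=
  3000 * (4 ^ l * (l + 1) ^ 4 * (N * (M + 1) ^ (2 * l + 1))) +
    (l + 1) * ((M + 1) * N) * (3 * polyCells l)

/-- A bound on the number of cells taken by a Taylor step. -/
def taylorCells (l M N : ℕ) : ℕ :=
  (l + 1) + M * N + (l + 1) * N + (l + 1) * M * N + (l + 1) * (l + 2) * M * N + (l + 1) * M +
    tensorCells M l + M * N + (scratchCells M l + M * (M + 1) + 5 * M + 1 + 3 * l)

namespace Cost

theorem taylorStepBody (c : Ctx) {l M N : ℕ} (β Δβ : ℝ) (hcl : c.l = l) (hcM : c.M = M)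
    (hcN : c.N = N) (hN : 1 ≤ N) :
    Cost 1 0 (do
      RDTracking.computeFactorials c
      RDTracking.computeEncoder c β
      RDTracking.computeExpectations c
      RDTracking.computeP c
      RDTracking.computeG c
      RDTracking.loop l fun k => RDTracking.implicitDeriv c (k + 1)
      RDTracking.emit β
      RDTracking.loop M fun i => do
        RDTracking.emit (← RDTracking.readCell (c.aR + i))
      RDTracking.loop l fun k => RDTracking.loop M fun i => do
        let v ← rdiv (← RDTracking.readCell (c.aX + (k + 1) * M + i))
          (← RDTracking.readCell (c.aF + (k + 1)))
        RDTracking.emit v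
      RDTracking.loop M fun i => do
        let s ← RDTracking.sumLoop l fun k => do
          let h ← rdiv (← RDTracking.rpowNat Δβ (k + 1)) (← RDTracking.readCell (c.aF + (k + 1)))
          rmul h (← RDTracking.readCell (c.aX + (k + 1) * M + i))
        let v ← radd (← RDTracking.readCell (c.aR + i)) s
        RDTracking.writeCell (c.aR + i) v
      modify fun s => { s with taylorSteps := s.taylorSteps + 1 })
    (8 * (l + 1) + 30 * ((M + 1) * N) + 40 * ((l + 1) * ((M + 1) * N)) +
      (l + 1) * ((M + 1) * N) * (3 * polyCells l + 5) +
      60 * (4 ^ l * (l + 1) ^ 3 * ((M + 1) * N)) +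
      l * (1200 * (4 ^ l * (l + 1) ^ 3 * (N * (M + 1) ^ (2 * l + 1))) + 1) +
      (1 + M * 3 + l * (M * 5 + 1) + M * (l * (l + 6) + 5)))
    (M * N + (scratchCells M l + M * (M + 1) + 5 * M + 1 + 3 * l)) := by
  subst hcl hcM hcN
  have hmod : Cost 1 0 (modify fun s : Machine => { s with taylorSteps := s.taylorSteps + 1 }) 0 0 :=
    ⟨fun _ => ⟨le_rfl, rfl, le_max_left _ _, rfl, rfl⟩⟩
  apply mono
  case h =>
    refine bind (computeFactorials c) fun _ => bind (computeEncoder c β hN) fun _ =>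
      bind (computeExpectations c hN) fun _ => bind (computeP c hN) fun _ =>
      bind (computeG c hN) fun _ =>
      bind (loop (T := 1200 * (4 ^ c.l * (c.l + 1) ^ 3 * (c.N * (c.M + 1) ^ (2 * c.l + 1))))
        (K := scratchCells c.M c.l + c.M * (c.M + 1) + 5 * c.M + 1 + 3 * c.l) fun k hk =>
        (implicitDeriv c (by omega) hk hN).mono ?_ le_rfl) fun _ =>
      bind (emit _) fun _ =>
      bind (loop (T := 2) (K := 0) fun _ _ =>
        ((readCell _).bind fun _ => emit _).mono le_rfl le_rfl) fun _ =>
      bind (loop (T := c.M * 5) (K := 0) fun _ _ => (loop fun _ _ =>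
        (readCell _).bind fun _ => (readCell _).bind fun _ => (op _).bind fun _ => emit _).mono
          le_rfl (by simp)) fun _ =>
      bind (loop (T := c.l * (c.l + 6) + 4) (K := 0) fun _ _ =>
        ((sumLoop (T := c.l + 5) (K := 0) fun k hk => ((rpowNat _ (show k + 1 ≤ c.l by omega)).bind
          fun _ => (readCell _).bind fun _ => (op _).bind fun _ => (readCell _).bind fun _ =>
          op _).mono (by omega) (by simp)).bind fun _ => (readCell _).bind fun _ =>
          (op _).bind fun _ => writeCell _ _).mono (by ring_nf; omega) (by simp)) fun _ => hmod
    have : k + 1 ≤ c.l := hk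
    gcongr <;> omega
  case hT => ring_nf; omega
  case hK => omega

theorem taylorStep (c : Ctx) (β Δβ : ℝ) (hl : 1 ≤ c.l) (hN : 1 ≤ c.N) :
    Cost 1 0 (taylorStep c β Δβ) (taylorTime c.l c.M c.N) (taylorCells c.l c.M c.N) := by
  unfold RDTracking.taylorStep
  dsimp only
  apply mono
  case h =>
    exact withCells fun aF => withCells fun aQ => withCells fun aE => withCells fun aPk =>
      withCells fun aG => withCells fun aX => withCells fun aT => taylorStepBody
        (l := c.l) (M := c.M) (N := c.N)
        { c with aF := aF, aQ := aQ, aE := aE, aPk := aPk, aG := aG, aX := aX, aT := aT } β Δβ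
        rfl rfl rfl hN
  case hT =>
    have hT := tensorCells_le c.M hl
    have hB1 : c.M + 1 ≤ (c.M + 1) ^ (2 * c.l + 1) := Nat.le_self_pow (by omega) _
    have hB2 : (c.M + 1) ^ (c.l + 1) ≤ (c.M + 1) ^ (2 * c.l + 1) :=
      Nat.pow_le_pow_right (by omega) (by omega)
    have hF := Nat.one_le_pow c.l 4 (by omega)
    rw [taylorTime]
    generalize (c.M + 1) ^ (2 * c.l + 1) = P at *
    generalize (c.M + 1) ^ (c.l + 1) = A at *
    generalize 4 ^ c.l = F at *
    generalize polyCells c.l = W at *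
    generalize tensorCells c.M c.l = Tc at *
    set Q := F * (c.l + 1) ^ 4 * (c.N * P) with hQ
    have e1 : (c.l + 1) ^ 2 * ((c.M + 1) * c.N) ≤ Q := by
      calc (c.l + 1) ^ 2 * ((c.M + 1) * c.N) = 1 * (c.l + 1) ^ 2 * (c.N * (c.M + 1)) := by ring
        _ ≤ _ := by rw [hQ]; gcongr <;> omega
    have e2 : F * (c.l + 1) ^ 3 * ((c.M + 1) * c.N) ≤ Q := by
      rw [hQ, mul_comm c.N]
      gcongr <;> omega
    have e3 : c.l * (F * (c.l + 1) ^ 3 * (c.N * P)) ≤ Q := by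
      calc c.l * (F * (c.l + 1) ^ 3 * (c.N * P)) ≤
            (c.l + 1) * (F * (c.l + 1) ^ 3 * (c.N * P)) := by gcongr; omega
        _ = Q := by rw [hQ]; ring
    have e4 : Tc ≤ Q := by
      refine hT.trans ?_
      calc (c.l + 1) ^ 2 * A = 1 * (c.l + 1) ^ 2 * (1 * A) := by ring
        _ ≤ _ := by rw [hQ]; gcongr <;> omega
    generalize Q = Q at *
    generalize F * (c.l + 1) ^ 3 * ((c.M + 1) * c.N) = R at *
    generalize F * (c.l + 1) ^ 3 * (c.N * P) = R' at *
    obtain ⟨n, hn⟩ := Nat.exists_eq_add_of_le hN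
    rw [hn] at e1 ⊢
    ring_nf at e1 e3 ⊢
    omega
  case hK =>
    rw [taylorCells]
    omega

end Cost
-- Amortized bounds for the unbounded loops
/-- Every run of `P` takes at most `K` additional cells, and at most `T` operations besides `τ`
for each Taylor step and `υ` for each Blahut-Arimoto iteration. -/
structure Amort {α : Type} (τ υ : ℤ) (P : Prog α) (T : ℤ) (K : ℕ) : Prop where
  time : ∀ s, ((P.run s).2.time : ℤ) ≤ s.time + T +
    τ * ((P.run s).2.taylorSteps - s.taylorSteps) + υ * ((P.run s).2.baIters - s.baIters)
  brk : ∀ s, (P.run s).2.brk = s.brk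
  peak : ∀ s, (P.run s).2.peak ≤ max s.peak (s.brk + K)

/-- The numbers of Taylor steps and iterations in `Cost` are exact, so their allowance may be
subtracted. The result can be negative, a credit for other parts of the program; hence the integers.
-/
theorem Cost.amort {α : Type} {a b T K : ℕ} {P : Prog α} (h : Cost a b P T K) (τ υ : ℤ) :
    Amort τ υ P (T - τ * a - υ * b) K where
  time s := by
    have := h.run s
    have h1 : ((P.run s).2.time : ℤ) ≤ s.time + T := by exact_mod_cast this.time
    rw [this.taylor, this.ba]
    push_cast
    linarith
  brk s := (h.run s).brk
  peak s := (h.run s).peak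

namespace Amort

variable {α β : Type} {τ υ T T' : ℤ} {K K' : ℕ}

theorem mono {P : Prog α} (h : Amort τ υ P T K) (hT : T ≤ T') (hK : K ≤ K') :
    Amort τ υ P T' K' where
  time s := by have := h.time s; linarith
  brk := h.brk
  peak s := by have := h.peak s; omega

theorem bindQ {P : Prog α} {f : α → Prog β} {Q : α → Prop} (hQ : Returns P Q)
    (h : Amort τ υ P T K) (hf : ∀ v, Q v → Amort τ υ (f v) T' K') :
    Amort τ υ (P >>= f) (T + T') (max K K') where
  time s := by
    have h1 := h.time s
    have h2 := (hf _ (hQ s)).time (P.run s).2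
    change (((f (P.run s).1).run (P.run s).2).2.time : ℤ) ≤ _ + _ + τ * (((f (P.run s).1).run
      (P.run s).2).2.taylorSteps - _) + υ * (((f (P.run s).1).run (P.run s).2).2.baIters - _)
    linarith
  brk s := ((hf _ (hQ s)).brk _).trans (h.brk s)
  peak s := by
    have h1 := h.peak s
    have h2 : ((P >>= f).run s).2.peak ≤ _ := (hf _ (hQ s)).peak (P.run s).2
    rw [h.brk s] at h2
    omega

theorem bind {P : Prog α} {f : α → Prog β} (h : Amort τ υ P T K)
    (hf : ∀ v, Amort τ υ (f v) T' K') : Amort τ υ (P >>= f) (T + T') (max K K') :=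
  bindQ (Q := fun _ => True) (fun _ => trivial) h fun v _ => hf v

theorem pure (v : α) : Amort τ υ (Pure.pure v) 0 0 := by
  simpa using (Cost.pure v).amort τ υ

end Amort

namespace Cost

theorem supportSize (aR n : ℕ) : Cost 0 0 (supportSize aR n) (2 * n + 1) 0 := by
  induction n with
  | zero => exact op _
  | succ n ih =>
    refine (ih.bind fun _ => (readCell _).bind fun _ => (op _).bind fun _ => pure _).mono ?_
      (by simp)
    omega

theorem reduceToSupport (aD aR N n : ℕ) :
    Cost 0 0 (reduceToSupport aD aR N n) (n * (3 * N + 3) + 1) 0 := by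
  induction n with
  | zero => exact (op _).mono (by simp) le_rfl
  | succ n ih =>
    refine (ih.bind fun _ => (readCell _).bind fun _ => (op _).bind fun _ => ite (pure _)
      ((writeCell _ _).bind fun _ => (loop fun _ _ => (readCell _).bind fun _ =>
        writeCell _ _).bind fun _ => pure _)).mono ?_ (by simp)
    ring_nf
    omega

theorem allAbove (aR : ℕ) (δ : ℝ) (n : ℕ) : Cost 0 0 (allAbove aR δ n) (2 * n + 1) 0 := by
  induction n with
  | zero => exact op _
  | succ n ih =>
    refine (ih.bind fun _ => (readCell _).bind fun _ => (op _).bind fun _ => pure _).mono ?_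
      (by simp)
    omega

theorem allClose (a a' : ℕ) (tol : ℝ) (n : ℕ) :
    Cost 0 0 (allClose a a' tol n) (6 * n + 1) 0 := by
  induction n with
  | zero => exact op _
  | succ n ih =>
    refine (ih.bind fun _ => (readCell _).bind fun _ => (readCell _).bind fun _ =>
      (op _).bind fun _ => (op _).bind fun _ => (op _).bind fun _ => (op _).bind fun _ =>
      pure _).mono ?_ (by simp)
    omega

theorem truncateAndNormalize (c : Ctx) (δ : ℝ) :
    Cost 0 0 (truncateAndNormalize c δ) (10 * c.M + 1) 0 := by
  unfold RDTracking.truncateAndNormalize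
  refine ((loop fun _ _ => (readCell _).bind fun _ => (op _).bind fun _ => ite (writeCell _ _)
    (pure _)).bind fun _ => (sumLoop fun _ _ => readCell _).bind fun _ => loop fun _ _ =>
    (readCell _).bind fun _ => (op _).bind fun _ => writeCell _ _).mono ?_ (by simp)
  omega

theorem blahutArimotoStep (c : Ctx) (β tol : ℝ) (hN : 1 ≤ c.N) :
    Cost 0 1 (blahutArimotoStep c β tol) (60 * ((c.M + 1) * c.N)) (c.M * c.N + c.M) := by
  have hmod : Cost 0 1 (modify fun s : Machine => { s with baIters := s.baIters + 1 }) 0 0 :=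
    ⟨fun _ => ⟨le_rfl, rfl, le_max_left _ _, rfl, rfl⟩⟩
  have hE (aQ : ℕ) : Cost 0 0 (RDTracking.computeEncoder { c with aQ := aQ } β)
    (30 * ((c.M + 1) * c.N)) 0 := computeEncoder _ β hN
  unfold RDTracking.blahutArimotoStep
  refine (withCells fun aQ => withCells fun aS => (hE aQ).bind fun _ => (loop fun _ _ =>
    (sumLoop fun _ _ => (readCell _).bind fun _ => (readCell _).bind fun _ => op _).bind fun _ =>
    writeCell _ _).bind fun _ => (allClose _ _ _ _).bind fun _ => (loop fun _ _ =>
    (readCell _).bind fun _ => writeCell _ _).bind fun _ =>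
    bindAux (a := 0) (b := 1) (a' := 0) (b' := 0) (Q := fun _ => True) (fun _ => trivial) hmod
      fun _ _ => pure _).mono ?_ ?_
  · obtain ⟨n, hn⟩ := Nat.exists_eq_add_of_le hN
    rw [hn]
    ring_nf
    omega
  · simp

end Cost

theorem Returns.bindQ {α β : Type} {P : Prog α} {f : α → Prog β} {Q : α → Prop} {Q' : β → Prop}
    (hP : Returns P Q) (h : ∀ v, Q v → Returns (f v) Q') : Returns (P >>= f) Q' :=
  fun s => h _ (hP s) (P.run s).2

theorem returns_reduceToSupport (aD aR N n : ℕ) :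
    Returns (reduceToSupport aD aR N n) (· ≤ n) := by
  induction n with
  | zero => exact fun _ => le_rfl
  | succ n ih =>
    refine Returns.bindQ ih fun j hj => Returns.bind fun r => Returns.bind fun z => ?_
    split
    · exact fun _ => hj.trans (Nat.le_succ n)
    · exact fun _ => Nat.succ_le_succ hj

variable {τ υ : ℤ}

/-- Each Taylor step also pays for updating `β` and for one stopping test; only one test remains
unpaid. -/
theorem amort_trackToBifurcation (c : Ctx) (Δβ δ : ℝ) (fuel : ℕ) (β : ℝ) (hl : 1 ≤ c.l)
    (hN : 1 ≤ c.N) (hτ : (taylorTime c.l c.M c.N : ℤ) + (2 * c.M + 3) ≤ τ) :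
    Amort τ υ (trackToBifurcation c Δβ δ fuel β) (2 * c.M + 2) (taylorCells c.l c.M c.N) := by
  induction fuel generalizing β with
  | zero => exact (Amort.pure β).mono (by positivity) (Nat.zero_le _)
  | succ fuel ih =>
    refine (Amort.bind ((Cost.allAbove c.aR δ c.M).amort τ υ) fun u =>
      Amort.bind ((Cost.op _).amort τ υ) fun v => Amort.mono (T' := 0)
        (K' := taylorCells c.l c.M c.N) (T := 0) (K := taylorCells c.l c.M c.N) ?_
          le_rfl le_rfl).mono ?_ ?_
    · split
      · refine (Amort.bind ((Cost.taylorStep c β Δβ hl hN).amort τ υ) fun _ =>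
          Amort.bind ((Cost.op _).amort τ υ) fun _ => ih _).mono ?_ ?_
        · push_cast
          linarith
        · omega
      · exact (Amort.pure β).mono le_rfl (Nat.zero_le _)
    · push_cast
      linarith
    · omega

theorem amort_blahutArimotoLoop (c : Ctx) (β tol : ℝ) (fuel : ℕ) (hN : 1 ≤ c.N)
    (hυ : (60 * ((c.M + 1) * c.N) : ℤ) ≤ υ) :
    Amort τ υ (blahutArimotoLoop c β tol fuel) 0 (c.M * c.N + c.M) := by
  induction fuel with
  | zero => exact (Amort.pure ()).mono le_rfl (Nat.zero_le _)
  | succ fuel ih =>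
    refine (Amort.bind (T' := 0) (K' := c.M * c.N + c.M)
      ((Cost.blahutArimotoStep c β tol hN).amort τ υ) fun done => ?_).mono ?_ ?_
    · split
      · exact (Amort.pure ()).mono le_rfl (Nat.zero_le _)
      · exact ih
    · push_cast
      linarith
    · omega

/-- With positive fuel at least one iteration is done, and what its allowance `υ` leaves over
becomes a credit for the round. -/
theorem amort_blahutArimotoLoop_succ (c : Ctx) (β tol : ℝ) (fuel : ℕ) (hN : 1 ≤ c.N)
    (hυ : (60 * ((c.M + 1) * c.N) : ℤ) ≤ υ) :
    Amort τ υ (blahutArimotoLoop c β tol (fuel + 1)) (60 * ((c.M + 1) * c.N) - υ)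
      (c.M * c.N + c.M) := by
  refine (Amort.bind (T' := 0) (K' := c.M * c.N + c.M)
    ((Cost.blahutArimotoStep c β tol hN).amort τ υ) fun done => ?_).mono ?_ ?_
  · split
    · exact (Amort.pure ()).mono le_rfl (Nat.zero_le _)
    · exact amort_blahutArimotoLoop c β tol fuel hN hυ
  · push_cast
    linarith
  · omega

theorem tensorCells_mono {M M' : ℕ} (h : M ≤ M') (l : ℕ) : tensorCells M l ≤ tensorCells M' l :=
  Finset.sum_le_sum fun _ _ => Finset.sum_le_sum fun _ _ => Nat.pow_le_pow_left h _

theorem scratchCells_mono {M M' : ℕ} (h : M ≤ M') (l : ℕ) :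
    scratchCells M l ≤ scratchCells M' l := by
  unfold scratchCells
  split
  · exact le_rfl
  · gcongr

theorem taylorCells_mono {M M' : ℕ} (h : M ≤ M') (l N : ℕ) :
    taylorCells l M N ≤ taylorCells l M' N := by
  have := tensorCells_mono h l
  have := scratchCells_mono h l
  unfold taylorCells
  gcongr

theorem taylorTime_mono {M M' : ℕ} (h : M ≤ M') (l N : ℕ) :
    taylorTime l M N ≤ taylorTime l M' N := by
  unfold taylorTime
  gcongr

/-- A bound on the number of cells taken by root tracking on at most `M` letters. -/
def trackingCells (l M N : ℕ) : ℕ := taylorCells l M N + (M * N + M)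

/-- A round of root tracking after the reduction to the support, and all the later rounds. -/
noncomputable def trackReduced (c : Ctx) (Δβ δ tol : ℝ) (fuel n M' : ℕ) (β : ℝ) : Prog Unit := do
  let c' : Ctx := { c with M := M' }
  let β' ← trackToBifurcation c' Δβ δ fuel β
  truncateAndNormalize c' δ
  blahutArimotoLoop c' β' tol fuel
  trackRounds c Δβ δ tol fuel n M' β'

/-- The gap between the allowance `100` and the cost `60` of the guaranteed iteration pays for the
round's fixed costs. The second statement keeps a credit for the preceding `reduceToSupport`, so a
full round leaves only the support test of the first statement unpaid, independently of the number
of rounds. -/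
theorem amort_trackRounds (c : Ctx) (Δβ δ tol : ℝ) (fuel n : ℕ) {M Mb : ℕ} (β : ℝ) (hl : 1 ≤ c.l)
    (hN : 1 ≤ c.N) (hM : M ≤ Mb) (hτ : (taylorTime c.l Mb c.N : ℤ) + (2 * Mb + 3) ≤ τ)
    (hυ : (100 * ((Mb + 1) * c.N) : ℤ) ≤ υ) :
    Amort τ υ (trackRounds c Δβ δ tol (fuel + 1) n M β) (2 * Mb + 2)
      (trackingCells c.l Mb c.N) ∧
    Amort τ υ (trackReduced c Δβ δ tol (fuel + 1) n M β) (- (Mb * (3 * c.N + 3) + 1))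
      (trackingCells c.l Mb c.N) := by
  have reduced (n M : ℕ) (β : ℝ) (hM : M ≤ Mb)
      (ih : ∀ β, Amort τ υ (trackRounds c Δβ δ tol (fuel + 1) n M β) (2 * Mb + 2)
        (trackingCells c.l Mb c.N)) :
      Amort τ υ (trackReduced c Δβ δ tol (fuel + 1) n M β) (- (Mb * (3 * c.N + 3) + 1))
        (trackingCells c.l Mb c.N) := by
    have hMN : M * c.N ≤ Mb * c.N := Nat.mul_le_mul_right _ hM
    have hMN' : (M : ℤ) * c.N ≤ Mb * c.N := by exact_mod_cast hMN
    have hM' : (M : ℤ) ≤ Mb := by exact_mod_cast hM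
    have hN' : (1 : ℤ) ≤ c.N := by exact_mod_cast hN
    have hMb : (Mb : ℤ) ≤ Mb * c.N := le_mul_of_one_le_right (by positivity) hN'
    have hT : (taylorTime c.l M c.N : ℤ) ≤ taylorTime c.l Mb c.N := by
      exact_mod_cast taylorTime_mono hM _ _
    refine (Amort.bind (amort_trackToBifurcation { c with M := M } Δβ δ (fuel + 1) β hl hN
      (by dsimp only; linarith)) fun β' => Amort.bind ((Cost.truncateAndNormalize
      { c with M := M } δ).amort τ υ) fun _ => Amort.bind (amort_blahutArimotoLoop_succ
      { c with M := M } β' tol fuel hN (by dsimp only; nlinarith)) fun _ => ih β').mono ?_ ?_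
    · push_cast
      nlinarith
    · have := taylorCells_mono hM c.l c.N
      unfold trackingCells
      dsimp only
      omega
  have rounds : ∀ M ≤ Mb, ∀ β, Amort τ υ (trackRounds c Δβ δ tol (fuel + 1) n M β) (2 * Mb + 2)
      (trackingCells c.l Mb c.N) := by
    induction n with
    | zero => exact fun _ _ _ => (Amort.pure ()).mono (by positivity) (Nat.zero_le _)
    | succ n ih =>
      intro M hM β
      have hM' : (M : ℤ) ≤ Mb := by exact_mod_cast hM
      have hMN : (M : ℤ) * (3 * c.N + 3) ≤ Mb * (3 * c.N + 3) := by gcongr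
      refine (Amort.bind ((Cost.supportSize c.aR M).amort τ υ) fun size =>
        Amort.bind ((Cost.op _).amort τ υ) fun pos => Amort.mono (T := 0)
          (K := trackingCells c.l Mb c.N) ?_ le_rfl le_rfl).mono ?_ ?_
      · split
        · refine (Amort.bindQ (returns_reduceToSupport c.aD c.aR c.N M)
            ((Cost.reduceToSupport _ _ _ _).amort τ υ) fun M' hM' =>
            reduced n M' β (hM'.trans hM) (ih M' (hM'.trans hM))).mono ?_ ?_
          · push_cast
            linarith
          · omega
        · exact (Amort.pure ()).mono le_rfl (Nat.zero_le _)
      · push_cast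
        linarith
      · omega
  exact ⟨rounds M hM β, reduced n M β hM fun β => rounds M hM β⟩

/-! ### Memory after the reduction to the support -/

/-- Every run of `P` leaves the content of the cell `a` unchanged. -/
def Keeps {α : Type} (P : Prog α) (a : ℕ) : Prop := ∀ s, (P.run s).2.mem a = s.mem a

namespace Keeps

variable {α β : Type} {a : ℕ}

theorem pure (v : α) : Keeps (Pure.pure v) a := fun _ => rfl

theorem bind {P : Prog α} {f : α → Prog β} (h : Keeps P a) (hf : ∀ v, Keeps (f v) a) :
    Keeps (P >>= f) a := fun s => (hf _ (P.run s).2).trans (h s)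

theorem bindQ {P : Prog α} {f : α → Prog β} {Q : α → Prop} (hQ : Returns P Q) (h : Keeps P a)
    (hf : ∀ v, Q v → Keeps (f v) a) : Keeps (P >>= f) a :=
  fun s => (hf _ (hQ s) (P.run s).2).trans (h s)

theorem op (v : α) : Keeps (do tick 1; Pure.pure v) a := fun _ => rfl

theorem readCell (i : ℕ) : Keeps (readCell i) a := fun _ => rfl

theorem writeCell {i : ℕ} (v : ℝ) (h : a ≠ i) : Keeps (writeCell i v) a := fun _ => if_neg h

theorem loop {n : ℕ} {f : ℕ → Prog Unit} (h : ∀ i < n, Keeps (f i) a) : Keeps (loop n f) a := by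
  induction n with
  | zero => exact pure ()
  | succ n ih =>
    exact bind (ih fun i hi => h i (by omega)) fun _ => bind (fun _ => rfl) fun _ => h n (by omega)

theorem supportSize (aR n : ℕ) : Keeps (supportSize aR n) a := by
  induction n with
  | zero => exact op _
  | succ n ih => exact ih.bind fun _ => (readCell _).bind fun _ => (op _).bind fun _ => pure _

/-- The compaction only moves letters downwards: marginal entries are written below position `n`,
and distortions end before `aR`. Entries not yet examined are therefore intact. -/
theorem reduceToSupport {aD aR N n i : ℕ} (h : aD + n * N ≤ aR) (hi : n ≤ i) :
    Keeps (reduceToSupport aD aR N n) (aR + i) := by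
  induction n with
  | zero => exact op _
  | succ n ih =>
    rw [Nat.succ_mul] at h
    refine bindQ (returns_reduceToSupport aD aR N n) (ih (by omega) (by omega)) fun j hj =>
      (readCell _).bind fun r => (op _).bind fun z => ?_
    split
    · exact pure _
    · refine (writeCell _ (by omega)).bind fun _ => (loop fun x hx => (readCell _).bind fun _ =>
        writeCell _ ?_).bind fun _ => pure _
      have := Nat.mul_le_mul_right N hj
      omega

end Keeps

theorem reduceToSupport_le_card {aD aR N n : ℕ} (h : aD + n * N ≤ aR) (s : Machine) :
    ((reduceToSupport aD aR N n).run s).1 ≤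
      ((Finset.range n).filter fun i => s.mem (aR + i) ≠ 0).card := by
  induction n with
  | zero => exact Nat.zero_le _
  | succ n ih =>
    have hn : aD + n * N ≤ aR := by rw [Nat.succ_mul] at h; omega
    have h1 := ih hn
    have h2 := Keeps.reduceToSupport hn le_rfl s
    rw [Finset.range_add_one, Finset.filter_insert]
    have key : ((reduceToSupport aD aR N (n + 1)).run s).1 =
        if s.mem (aR + n) = 0 then ((reduceToSupport aD aR N n).run s).1
        else ((reduceToSupport aD aR N n).run s).1 + 1 := by
      -- The zero test at letter `n` sees the original entry, since the treatment of the earlier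
      -- letters did not touch it.
      rw [← h2]
      generalize hu : (reduceToSupport aD aR N n).run s = u
      change (Prod.fst (StateT.run (m := Id) (if decide (((reduceToSupport aD aR N n).run s).2.mem
        (aR + n) = 0) = true then pure ((reduceToSupport aD aR N n).run s).1 else do
        writeCell (aR + ((reduceToSupport aD aR N n).run s).1)
          (((reduceToSupport aD aR N n).run s).2.mem (aR + n))
        loop N fun x => do
          writeCell (aD + ((reduceToSupport aD aR N n).run s).1 * N + x)
            (← readCell (aD + n * N + x))
        pure (((reduceToSupport aD aR N n).run s).1 + 1) : Prog ℕ)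
        { ((reduceToSupport aD aR N n).run s).2 with
          time := ((reduceToSupport aD aR N n).run s).2.time + 1 + 1 })) = _
      rw [hu]
      simp only [decide_eq_true_eq]
      split <;> rfl
    rw [key]
    by_cases hz : s.mem (aR + n) = 0
    · rw [if_pos hz, if_neg (not_not.2 hz)]
      exact h1
    · rw [if_neg hz, if_pos hz, Finset.card_insert_of_notMem (by simp)]
      omega

/-- The first round is separated because before its reduction the size is `M`, but no cells are
taken there. Afterwards the size never exceeds `W`, and the amortized bound applies with `W`. -/
theorem peak_trackRounds_le (c : Ctx) (Δβ δ tol : ℝ) (fuel n M W : ℕ) (β : ℝ) (s : Machine)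
    (hl : 1 ≤ c.l) (hN : 1 ≤ c.N) (hD : c.aD + M * c.N ≤ c.aR)
    (hW : ((Finset.range M).filter fun i => s.mem (c.aR + i) ≠ 0).card ≤ W) :
    ((trackRounds c Δβ δ tol (fuel + 1) n M β).run s).2.peak ≤
      max s.peak (s.brk + trackingCells c.l W c.N) := by
  cases n with
  | zero => exact le_max_left _ _
  | succ n =>
    have hs := (Cost.supportSize c.aR M).run s
    obtain ⟨s', hs', hmem, hpeak, hbrk⟩ : ∃ s' : Machine,
        s' = { ((supportSize c.aR M).run s).2 with
          time := ((supportSize c.aR M).run s).2.time + 1 } ∧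
        (∀ i, s'.mem i = s.mem i) ∧ s'.peak ≤ max s.peak (s.brk + 0) ∧ s'.brk = s.brk :=
      ⟨_, rfl, fun _ => Keeps.supportSize c.aR M s, hs.peak, hs.brk⟩
    change (StateT.run (if _ then reduceToSupport c.aD c.aR c.N M >>= fun M' =>
      trackReduced c Δβ δ tol (fuel + 1) n M' β else pure ())
      { ((supportSize c.aR M).run s).2 with
        time := ((supportSize c.aR M).run s).2.time + 1 }).2.peak ≤ _
    rw [← hs']
    split
    · have h1 := (Cost.reduceToSupport c.aD c.aR c.N M).run s'
      have h2 := reduceToSupport_le_card hD s'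
      simp only [hmem] at h2
      refine ((amort_trackRounds c Δβ δ tol fuel n β hl hN (h2.trans hW) le_rfl le_rfl).2.peak
        ((reduceToSupport c.aD c.aR c.N M).run s').2).trans ?_
      have h4 := h1.peak
      have h5 := h1.brk
      omega
    · change s'.peak ≤ _
      omega

/-! ### Support size of a nonsingular root -/

/-- A nonsingular root has at most as many letters in its support as the source. -/
theorem IsNonsingularRoot.card_support_le {X Y : Type*} [Fintype X] [Fintype Y]
    {d : X → Y → ℝ} {p : X → ℝ} {β : ℝ} {r : Y → ℝ} (h : IsNonsingularRoot d p β r)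
    (S : Finset Y) (hS : ∀ y, y ∈ S ↔ r y ≠ 0) : S.card ≤ Fintype.card X := by
  obtain ⟨-, hroot, hbij⟩ := h
  have hinj := (hbij S hS).1
  set F := fun s : S → ℝ => s - blahutArimoto (fun x (y : S) => d x y) p β s with hF
  by_contra! hlt
  -- `A` sends a marginal on the support to its partition functions. With more letters than source
  -- symbols it has a kernel vector `v`, and moving along `v` keeps every denominator of `BA_β`
  -- fixed.
  let A : (S → ℝ) →ₗ[ℝ] (X → ℝ) := Matrix.mulVecLin (Matrix.of fun x (y : S) => Real.exp (-(β * d x y)))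
  obtain ⟨v, hv, hv0⟩ : ∃ v ∈ LinearMap.ker A, v ≠ 0 := by
    refine (Submodule.ne_bot_iff _).1 (LinearMap.ker_ne_bot_of_finrank_lt ?_)
    simpa using hlt
  have hA (x : X) : ∑ y : S, v y * Real.exp (-(β * d x y)) = 0 := by
    have := congrFun (LinearMap.mem_ker.1 hv) x
    simpa [A, Matrix.mulVec, dotProduct, mul_comm] using this
  have hsum (x : X) : ∑ y : S, r y * Real.exp (-(β * d x y)) =
      ∑ y, r y * Real.exp (-(β * d x y)) := by
    rw [Finset.sum_coe_sort S fun y => r y * Real.exp (-(β * d x y))]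
    refine Finset.sum_subset (Finset.subset_univ _) fun y _ hy => ?_
    rw [hS, not_not] at hy
    rw [hy, zero_mul]
  have hline (t : ℝ) : F ((fun y : S => r y) + t • v) = 0 := by
    funext y
    -- At a root, the factor multiplying a nonzero `r y` must be `1`. It depends on the marginal
    -- only through the partition functions, so the whole line consists of zeros of `F`.
    have hy : ∑ x, p x * Real.exp (-(β * d x y)) / ∑ y', r y' * Real.exp (-(β * d x y')) = 1 :=
      mul_left_cancel₀ ((hS y).1 y.2) (by simpa [blahutArimoto] using congrFun hroot y)
    have hZ (x : X) : ∑ y' : S, (r y' + t * v y') * Real.exp (-(β * d x y')) =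
        ∑ y', r y' * Real.exp (-(β * d x y')) := by
      simp only [add_mul, Finset.sum_add_distrib, mul_assoc, ← Finset.mul_sum, hA, mul_zero,
        add_zero, hsum]
    simp only [hF, Pi.sub_apply, blahutArimoto, Pi.add_apply, Pi.smul_apply, smul_eq_mul, hZ, hy,
      mul_one, sub_self, Pi.zero_apply]
  have hker : fderiv ℝ F (fun y : S => r y) v = 0 := by
    -- Differentiability need not be checked: otherwise `fderiv` is `0` by convention and kills `v`
    -- as well.
    by_cases hdiff : DifferentiableAt ℝ F (fun y : S => r y)
    · have h1 : HasLineDerivAt ℝ F (fderiv ℝ F (fun y : S => r y) v) (fun y : S => r y) v :=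
        hdiff.hasFDerivAt.hasLineDerivAt v
      refine HasDerivAt.unique h1 ?_
      simp only [hline]
      exact hasDerivAt_const _ _
    · rw [fderiv_zero_of_not_differentiableAt hdiff]
      rfl
  exact hv0 (hinj (hker.trans (map_zero _).symm))

/-! ### Numerical estimates -/

theorem length_le_of_mem_polyP {k : ℕ} {u : Bool × List ℕ} (hu : u ∈ polyP k) :
    u.2.length ≤ k := by
  induction k generalizing u with
  | zero => simp [polyP] at hu; simp [hu]
  | succ k ih =>
    simp only [polyP, List.mem_flatMap, List.mem_cons] at hu
    obtain ⟨w, hw, rfl | rfl | hu⟩ := hu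
    · simpa using ih hw
    · simpa using ih hw
    · simp only [dbar, List.mem_flatMap] at hu
      obtain ⟨i, -, hi⟩ := hu
      split at hi
      · simp at hi
      · simp only [List.mem_cons, List.not_mem_nil, or_false] at hi
        rcases hi with rfl | rfl
        · simpa using ih hw
        · simpa using (ih hw).trans (Nat.le_succ k)

theorem length_dbar_le (u : Bool × List ℕ) : (dbar u).length ≤ 2 * u.2.length := by
  rw [dbar, List.length_flatMap]
  refine (List.sum_le_card_nsmul _ 2 ?_).trans (by simp [mul_comm])
  simp only [List.mem_map]
  rintro _ ⟨i, -, rfl⟩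
  split <;> simp

/-- A monomial of `P_k` has at most `k` variables, so it produces at most `2 + 2 * k` monomials of
`P_{k+1}`. -/
theorem length_polyP_le (k : ℕ) : (polyP k).length ≤ 2 ^ k * k.factorial := by
  induction k with
  | zero => simp [polyP]
  | succ k ih =>
    rw [polyP, List.length_flatMap]
    refine (List.sum_le_card_nsmul _ (2 * (k + 1)) ?_).trans ?_
    · simp only [List.mem_map]
      rintro _ ⟨u, hu, rfl⟩
      have h1 := length_dbar_le u
      have h2 := length_le_of_mem_polyP hu
      simp only [List.length_cons]
      omega
    · rw [List.length_map, smul_eq_mul, pow_succ, Nat.factorial_succ]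
      calc _ ≤ 2 ^ k * k.factorial * (2 * (k + 1)) := Nat.mul_le_mul_right _ ih
        _ = _ := by ring

/-- Bernoulli's inequality for `(1 + 1 / x) ^ m`, cleared of denominators. At `x = m = l` it gives
`2 * l ^ l ≤ (l + 1) ^ l`. -/
theorem pow_mul_add_le_succ_pow_mul (x m : ℕ) : x ^ m * (x + m) ≤ (x + 1) ^ m * x := by
  induction m with
  | zero => simp
  | succ m ih =>
    rw [pow_succ, pow_succ]
    nlinarith [Nat.zero_le (x ^ m * m)]

theorem two_pow_mul_factorial_le {l : ℕ} (hl : 1 ≤ l) : 2 ^ l * l.factorial ≤ 2 * l ^ l := by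
  induction l, hl using Nat.le_induction with
  | base => simp
  | succ l hl ih =>
    have h : 2 * l ^ l ≤ (l + 1) ^ l := by
      have := pow_mul_add_le_succ_pow_mul l l
      refine Nat.le_of_mul_le_mul_right ?_ hl
      linarith
    rw [pow_succ, Nat.factorial_succ, pow_succ]
    calc _ = 2 * (l + 1) * (2 ^ l * l.factorial) := by ring
      _ ≤ 2 * (l + 1) * (l + 1) ^ l := Nat.mul_le_mul_left _ (ih.trans h)
      _ = _ := by ring

theorem sum_two_pow_mul_factorial_le (l : ℕ) :
    ∑ k ∈ Finset.range (l + 1), 2 ^ k * k.factorial ≤ 2 * (2 ^ l * l.factorial) := by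
  induction l with
  | zero => simp
  | succ l ih =>
    rw [Finset.sum_range_succ]
    have : 2 * (2 ^ l * l.factorial) ≤ 2 ^ (l + 1) * (l + 1).factorial := by
      rw [pow_succ', mul_assoc]
      gcongr
      omega
    omega

theorem polyCells_le {l : ℕ} (hl : 1 ≤ l) : polyCells l ≤ 8 * l ^ (l + 1) := by
  have h (k : ℕ) (hk : k ∈ Finset.range (l + 1)) :
      ((polyP k).map fun u => 1 + u.2.length).sum ≤ 2 ^ k * k.factorial * (l + 1) := by
    have hk' : k ≤ l := Finset.mem_range_succ_iff.1 hk
    refine (List.sum_le_card_nsmul _ (l + 1) ?_).trans ?_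
    · simp only [List.mem_map]
      rintro _ ⟨u, hu, rfl⟩
      have := length_le_of_mem_polyP hu
      omega
    · rw [List.length_map, smul_eq_mul]
      exact Nat.mul_le_mul_right _ (length_polyP_le k)
  calc polyCells l ≤ ∑ k ∈ Finset.range (l + 1), 2 ^ k * k.factorial * (l + 1) :=
        Finset.sum_le_sum h
    _ ≤ 2 * (2 * l ^ l) * (2 * l) := by
        rw [← Finset.sum_mul]
        refine Nat.mul_le_mul ((sum_two_pow_mul_factorial_le l).trans ?_) (by omega)
        exact Nat.mul_le_mul_left _ (two_pow_mul_factorial_le hl)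
    _ = _ := by ring

/-- Exponential factors are absorbed by a constant: small `l` are covered by `K ^ K`, and for `l >
K` the base `S` exceeds `K`. -/
theorem pow_le_pow_self_mul_pow (K : ℕ) {l S : ℕ} (hl : 2 ≤ l) (hK : 2 ≤ K) (hS : l + 1 ≤ S) :
    K ^ l ≤ K ^ K * S ^ (l - 2) := by
  by_cases h : l ≤ K
  · calc K ^ l ≤ K ^ K * 1 := by rw [mul_one]; exact Nat.pow_le_pow_right (by omega) h
      _ ≤ _ := Nat.mul_le_mul_left _ (Nat.one_le_pow _ _ (by omega))
  · calc K ^ l = K ^ 2 * K ^ (l - 2) := by rw [← pow_add]; congr 1; omega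
      _ ≤ _ := Nat.mul_le_mul (Nat.pow_le_pow_right (by omega) hK)
        (Nat.pow_le_pow_left (by omega) _)

theorem taylorTime_le {l M N : ℕ} (hl : 2 ≤ l) (hM : 1 ≤ M) (hN : 1 ≤ N) :
    taylorTime l M N + (2 * M + 3) ≤ 4000 * 64 ^ 64 * (N * (M + l) ^ (3 * l)) := by
  have hS : 1 ≤ M + l := by omega
  have e1 : 4 ^ l * (l + 1) ^ 4 * (N * (M + 1) ^ (2 * l + 1)) ≤
      64 ^ 64 * (N * (M + l) ^ (3 * l)) := by
    have h1 : (l + 1) ^ 4 ≤ 16 ^ l := by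
      calc (l + 1) ^ 4 ≤ (2 ^ l) ^ 4 := Nat.pow_le_pow_left Nat.lt_two_pow_self 4
        _ = 16 ^ l := by rw [← pow_mul, mul_comm, pow_mul]; norm_num
    calc 4 ^ l * (l + 1) ^ 4 * (N * (M + 1) ^ (2 * l + 1)) ≤
          4 ^ l * 16 ^ l * (N * (M + l) ^ (2 * l + 1)) := by gcongr; omega
      _ = 64 ^ l * (N * (M + l) ^ (2 * l + 1)) := by rw [← mul_pow]; norm_num
      _ ≤ 64 ^ 64 * (M + l) ^ (l - 2) * (N * (M + l) ^ (2 * l + 1)) := by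
          refine Nat.mul_le_mul_right _ (pow_le_pow_self_mul_pow 64 hl (by norm_num) (by omega))
      _ = 64 ^ 64 * (N * (M + l) ^ (l - 2 + (2 * l + 1))) := by rw [pow_add]; ring
      _ ≤ _ := by gcongr; omega
  have e2 : (l + 1) * ((M + 1) * N) * polyCells l ≤ 8 * (N * (M + l) ^ (3 * l)) := by
    calc (l + 1) * ((M + 1) * N) * polyCells l ≤
          (M + l) * ((M + l) * N) * (8 * (M + l) ^ (l + 1)) := by
          have := Nat.pow_le_pow_left (show l ≤ M + l by omega) (l + 1)
          refine Nat.mul_le_mul (Nat.mul_le_mul (by omega) (Nat.mul_le_mul_right _ (by omega)))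
            ((polyCells_le (show 1 ≤ l by omega)).trans (Nat.mul_le_mul_left _ this))
      _ = 8 * (N * (M + l) ^ (l + 3)) := by ring
      _ ≤ _ := by gcongr; omega
  have e3 : M + l ≤ N * (M + l) ^ (3 * l) :=
    (Nat.le_self_pow (by omega) _).trans (Nat.le_mul_of_pos_left _ hN)
  have e4 : N * (M + l) ^ (3 * l) ≤ 64 ^ 64 * (N * (M + l) ^ (3 * l)) :=
    Nat.le_mul_of_pos_left _ (by positivity)
  rw [taylorTime]
  rw [mul_assoc 4000]
  generalize 64 ^ 64 * (N * (M + l) ^ (3 * l)) = X at *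
  linarith

theorem le_costBound {l M N : ℕ} (hl : 1 ≤ l) (hM : 1 ≤ M) :
    (N : ℝ) * ((M : ℝ) + l) ^ (3 * l) ≤ costBound l M N := by
  have hM' : (1 : ℝ) ≤ M := by exact_mod_cast hM
  have hl' : (1 : ℝ) ≤ l := by exact_mod_cast hl
  have h1 : ((M : ℝ) + l) ^ (3 * l) ≤ ((M : ℝ) + l) ^ (3 * (l : ℝ) + 5 / 2) := by
    rw [← Real.rpow_natCast]
    refine Real.rpow_le_rpow_of_exponent_le (by linarith) ?_
    push_cast
    linarith
  have h2 : 0 ≤ Real.binEntropy (2 * (M : ℝ) / (2 * (M : ℝ) + l)) :=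
    Real.binEntropy_nonneg (by positivity) (div_le_one_of_le₀ (by linarith) (by positivity))
  have h3 := Real.pi_pos
  rw [costBound]
  calc (N : ℝ) * ((M : ℝ) + l) ^ (3 * l) ≤ N * ((M : ℝ) + l) ^ (3 * (l : ℝ) + 5 / 2) * 1 := by
        rw [mul_one]
        gcongr
    _ ≤ _ := by
        gcongr
        exact Real.one_le_exp (by positivity)

theorem taylorTime_one_le {M N : ℕ} (hM : 1 ≤ M) (hN : 1 ≤ N) :
    taylorTime 1 M N + (2 * M + 3) ≤ 4000000 * (M ^ 3 * N) := by
  have h1 := polyCells_le le_rfl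
  have h2 : (M + 1) ^ 3 ≤ 8 * M ^ 3 := by
    calc (M + 1) ^ 3 ≤ (2 * M) ^ 3 := by gcongr; omega
      _ = _ := by ring
  have h3 : M ≤ M ^ 3 := Nat.le_self_pow (by omega) _
  have h4 := Nat.mul_le_mul_right N h3
  have h5 := Nat.le_mul_of_pos_right M hN
  have h6 := Nat.mul_le_mul_right N h2
  have h7 := Nat.mul_le_mul_left ((1 + 1) * ((M + 1) * N)) (Nat.mul_le_mul_left 3 h1)
  have h8 := Nat.mul_le_mul_right N hM
  rw [taylorTime]
  ring_nf at *
  omega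

/-- A geometric sum dominated by its top term if `M ≥ 2`; the summand `m + 1` is for `M = 1`, where
all terms equal `1`. Summed over the orders it contributes at most `l ^ 2`, which fits into `M * N *
l ^ 2`. -/
theorem orderCells_le {M : ℕ} (hM : 1 ≤ M) (m : ℕ) :
    orderCells M m ≤ 2 * M ^ (m + 1) + (m + 1) := by
  induction m with
  | zero => simp [orderCells]; omega
  | succ m ih =>
    have h : orderCells M (m + 1) = orderCells M m + M ^ (m + 2) := by
      simp only [orderCells]
      rw [Finset.sum_range_succ']
      simp
    have h1 : M ^ (m + 2) = M * M ^ (m + 1) := by ring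
    rcases hM.eq_or_lt with rfl | hM
    · simp at *
      omega
    · have : 2 * M ^ (m + 1) ≤ M * M ^ (m + 1) := Nat.mul_le_mul_right _ hM
      rw [h, show m + 1 + 1 = m + 2 from rfl, h1]
      omega

theorem trackingCells_le {l M N : ℕ} (hl : 2 ≤ l) (hM : 1 ≤ M) (hN : 1 ≤ N) :
    trackingCells l M N ≤ 50 * (M * N * l ^ 2 + M ^ l * l) := by
  have h1 : tensorCells M l ≤ M * N * l ^ 2 + 2 * (M ^ l * l) := by
    have h2 (m : ℕ) (hm : m ∈ Finset.Icc 1 (l - 1)) : orderCells M m ≤ 2 * M ^ l + l := by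
      rw [Finset.mem_Icc] at hm
      refine (orderCells_le hM m).trans ?_
      have := Nat.pow_le_pow_right hM (show m + 1 ≤ l by omega)
      omega
    rw [tensorCells, max_eq_right (by omega)]
    calc _ ≤ ∑ m ∈ Finset.Icc 1 (l - 1), (2 * M ^ l + l) := Finset.sum_le_sum h2
      _ = (l - 1) * (2 * M ^ l + l) := by simp
      _ ≤ l * (2 * M ^ l + l) := by gcongr; omega
      _ = 1 * 1 * l ^ 2 + 2 * (M ^ l * l) := by ring
      _ ≤ _ := by gcongr
  have h3 : M * M ≤ M ^ l * l := by
    calc M * M = M ^ 2 * 1 := by ring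
      _ ≤ _ := by gcongr; omega
  have h4 : M ^ l ≤ M ^ l * l := Nat.le_mul_of_pos_right _ (by omega)
  have h5 := Nat.one_le_pow l M hM
  rw [trackingCells, taylorCells, scratchCells, if_neg (by omega)]
  obtain ⟨m, rfl⟩ := Nat.exists_eq_add_of_le hM
  obtain ⟨n, rfl⟩ := Nat.exists_eq_add_of_le hN
  obtain ⟨k, rfl⟩ := Nat.exists_eq_add_of_le hl
  generalize tensorCells (1 + m) (2 + k) = Tc at *
  generalize (1 + m) ^ (2 + k) = P at *
  ring_nf at *
  omega

/-- The Jacobian and the augmented matrix take about `W ^ 2` cells each, and `W ^ 2 ≤ W * N ≤ M *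
N`. -/
theorem trackingCells_one_le {W M N : ℕ} (hM : 1 ≤ M) (hN : 1 ≤ N) (hWM : W ≤ M) (hWN : W ≤ N) :
    trackingCells 1 W N ≤ 50 * (M * N) := by
  have h1 : tensorCells W 1 = W ^ 2 + W := by
    simp [tensorCells, orderCells, Finset.sum_range_succ]
  have h2 := Nat.mul_le_mul_left W hWN
  have h3 := Nat.mul_le_mul_right N hWM
  have h4 := Nat.le_mul_of_pos_right M hN
  have h5 := Nat.le_mul_of_pos_left N hM
  rw [trackingCells, taylorCells, scratchCells, if_pos rfl, h1]
  ring_nf at *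
  omega

theorem polyCells_le_memoryBound {l M N : ℕ} (hl : 1 ≤ l) (hM : 1 ≤ M) (hN : 1 ≤ N) :
    (polyCells l : ℝ) ≤ 16 * memoryBound l M N := by
  have hM' : (1 : ℝ) ≤ M := by exact_mod_cast hM
  have hl' : (1 : ℝ) ≤ l := by exact_mod_cast hl
  have hN' : (1 : ℝ) ≤ N := by exact_mod_cast hN
  have h1 : (polyCells l : ℝ) ≤ 8 * (l : ℝ) ^ (l + 1) := by exact_mod_cast polyCells_le hl
  have h2 : (l : ℝ) ^ (l + 1) ≤ 2 * ((l : ℝ) ^ ((l : ℝ) + 5 / 2) * Real.log l) + 1 := by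
    -- For `l = 1` the logarithm vanishes; the summand `1` takes over and is absorbed later by `M *
    -- N * l ^ 2`.
    rcases hl.eq_or_lt with rfl | hl2
    · simp
    · have h3 : Real.log 2 ≤ Real.log l :=
        Real.log_le_log (by norm_num) (by exact_mod_cast hl2)
      have h4 := Real.log_two_gt_d9
      have h5 : (l : ℝ) ^ (l + 1) ≤ (l : ℝ) ^ ((l : ℝ) + 5 / 2) := by
        rw [← Real.rpow_natCast]
        refine Real.rpow_le_rpow_of_exponent_le hl' ?_
        push_cast
        linarith
      have h6 : 0 ≤ (l : ℝ) ^ ((l : ℝ) + 5 / 2) := by positivity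
      nlinarith
  have h7 : (1 : ℝ) ≤ M * N * (l : ℝ) ^ 2 := by
    have : 1 ≤ M * N * l ^ 2 := Nat.one_le_iff_ne_zero.2 (by positivity)
    exact_mod_cast this
  have h8 : (0 : ℝ) ≤ (M : ℝ) ^ l * l := by positivity
  rw [memoryBound]
  linarith

theorem cells_le_memoryBound {l M N W : ℕ} (hl : 1 ≤ l) (hM : 1 ≤ M) (hN : 1 ≤ N) (hWM : W ≤ M)
    (hW : 2 ≤ l ∨ W ≤ N) :
    ((M * N + N + M + polyCells l + trackingCells l W N : ℕ) : ℝ) ≤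
      70 * memoryBound l M N := by
  have h1 := polyCells_le_memoryBound hl hM hN
  have h2 : M * N + N + M + trackingCells l W N ≤ 53 * (M * N * l ^ 2 + M ^ l * l) := by
    have e1 : M * N ≤ M * N * l ^ 2 := Nat.le_mul_of_pos_right _ (by positivity)
    have e2 := Nat.le_mul_of_pos_right M hN
    have e3 := Nat.le_mul_of_pos_left N hM
    rcases hl.eq_or_lt with rfl | hl2
    · have := trackingCells_one_le hM hN hWM (by omega)
      omega
    · have e4 := taylorCells_mono hWM l N
      have e5 := Nat.mul_le_mul_right N hWM
      have := trackingCells_le hl2 hM hN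
      rw [trackingCells] at this ⊢
      omega
  have h3 : ((M * N + N + M + trackingCells l W N : ℕ) : ℝ) ≤
      53 * ((M : ℝ) * N * (l : ℝ) ^ 2 + (M : ℝ) ^ l * l) := by exact_mod_cast h2
  have h4 : 0 ≤ (l : ℝ) ^ ((l : ℝ) + 5 / 2) * Real.log l :=
    mul_nonneg (by positivity) (Real.log_natCast_nonneg l)
  rw [memoryBound] at *
  push_cast at *
  linarith

/-! ### The complete run -/

section

variable (l : ℕ) {M N : ℕ} (d : Fin N → Fin M → ℝ) (p : Fin N → ℝ) (r₀ : Fin M → ℝ)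
  (β₀ Δβ δ tol : ℝ) (fuel : ℕ)

/-- The sizes and addresses at the start of root tracking. -/
def initialCtx (l M N : ℕ) : Ctx where
  l := l
  N := N
  M := M
  aD := 0
  aP := M * N
  aR := M * N + N
  aF := 0
  aQ := 0
  aE := 0
  aPk := 0
  aG := 0
  aX := 0
  aT := 0

/-- The initial state after the cells for the polynomials have been reserved. -/
noncomputable def loadedMachine : Machine :=
  { initialMachine d p r₀ with
    brk := M * N + N + M + polyCells l
    peak := max (M * N + N + M) (M * N + N + M + polyCells l)
    time := 0 + polyCells l
    mem := fun i => if M * N + N + M ≤ i ∧ i < M * N + N + M + polyCells l then 0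
      else (initialMachine d p r₀).mem i }

theorem rootTracking_eq :
    rootTracking l d p r₀ β₀ Δβ δ tol fuel =
      { ((trackRounds (initialCtx l M N) Δβ δ tol fuel fuel M β₀).run (loadedMachine l d p r₀)).2 with
        brk := M * N + N + M } := rfl

theorem mem_loadedMachine {i : ℕ} (hi : i < M) :
    (loadedMachine l d p r₀).mem (M * N + N + i) = r₀ ⟨i, hi⟩ := by
  have h1 : ¬ M * N + N + i < M * N := by omega
  have h2 : ¬ M * N + N + i - M * N < N := by omega
  have h3 : M * N + N + i - M * N - N = i := by omega
  change (if M * N + N + M ≤ M * N + N + i ∧ _ then (0 : ℝ) else _) = _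
  rw [if_neg (by omega)]
  simp only [initialMachine, h1, h2, h3, hi, dite_true, dite_false]

variable {l}

theorem time_rootTracking_le (hl : 1 ≤ l) (hN : 1 ≤ N) :
    (rootTracking l d p r₀ β₀ Δβ δ tol fuel).time ≤
      (taylorTime l M N + (2 * M + 3)) * (rootTracking l d p r₀ β₀ Δβ δ tol fuel).gridPoints +
        100 * ((M + 1) * N) * (rootTracking l d p r₀ β₀ Δβ δ tol fuel).baIters := by
  -- Loading the polynomials is charged to the grid point that `gridPoints` counts beyond the Taylor
  -- steps; the `2 * M + 3` of that point covers the first support test.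
  have h0 : polyCells l ≤ taylorTime l M N := by
    rw [taylorTime]
    refine le_add_left ?_
    calc polyCells l = 1 * (1 * 1) * (1 * polyCells l) := by ring
      _ ≤ _ := by gcongr <;> omega
  have h : Amort (taylorTime l M N + (2 * M + 3) : ℕ) (100 * ((M + 1) * N) : ℕ)
      (trackRounds (initialCtx l M N) Δβ δ tol fuel fuel M β₀) (2 * M + 2)
      (trackingCells l M N) := by
    cases fuel with
    | zero => exact (Amort.pure ()).mono (by positivity) (Nat.zero_le _)
    | succ fuel =>
      exact (amort_trackRounds (initialCtx l M N) Δβ δ tol fuel (fuel + 1) β₀ hl hN le_rfl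
        (by push_cast; exact le_rfl) (by push_cast; exact le_rfl)).1
  have h1 := h.time (loadedMachine l d p r₀)
  rw [rootTracking_eq, Machine.gridPoints]
  generalize ((trackRounds (initialCtx l M N) Δβ δ tol fuel fuel M β₀).run
    (loadedMachine l d p r₀)).2 = s at *
  have e1 : (loadedMachine l d p r₀).time = 0 + polyCells l := rfl
  have e2 : (loadedMachine l d p r₀).taylorSteps = 0 := rfl
  have e3 : (loadedMachine l d p r₀).baIters = 0 := rfl
  rw [e1, e2, e3] at h1
  dsimp only
  zify at h0 ⊢
  push_cast at h1
  linarith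

theorem peak_rootTracking_le (hl : 1 ≤ l) (hN : 1 ≤ N) :
    (rootTracking l d p r₀ β₀ Δβ δ tol fuel).peak ≤
      M * N + N + M + polyCells l +
        trackingCells l (Finset.univ.filter fun i => r₀ i ≠ 0).card N := by
  rw [rootTracking_eq]
  cases fuel with
  | zero =>
    change max (M * N + N + M) (M * N + N + M + polyCells l) ≤ _
    omega
  | succ fuel =>
    refine (peak_trackRounds_le (initialCtx l M N) Δβ δ tol fuel (fuel + 1) M
      (Finset.univ.filter fun i => r₀ i ≠ 0).card β₀ (loadedMachine l d p r₀) hl hN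
      (by simp [initialCtx]) ?_).trans ?_
    · refine le_of_eq (Finset.card_bij' (fun i hi => ⟨i, Finset.mem_range.1
        (Finset.mem_filter.1 hi).1⟩) (fun i _ => i) ?_ ?_ ?_ ?_)
      · intro i hi
        obtain ⟨hi1, hi2⟩ := Finset.mem_filter.1 hi
        refine Finset.mem_filter.2 ⟨Finset.mem_univ _, ?_⟩
        rw [← mem_loadedMachine l d p r₀ (Finset.mem_range.1 hi1)]
        exact hi2
      · intro i hi
        have : (loadedMachine l d p r₀).mem (M * N + N + i) = r₀ i :=
          mem_loadedMachine l d p r₀ i.2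
        exact Finset.mem_filter.2 ⟨Finset.mem_range.2 i.2,
          fun h => (Finset.mem_filter.1 hi).2 (this.symm.trans h)⟩
      · intros; rfl
      · intros; rfl
    · change max (max (M * N + N + M) (M * N + N + M + polyCells l)) _ ≤ _
      refine max_le (by omega) le_rfl

end

end RDTracking

theorem mainTheorem11 :
    ∃ C : ℝ, 0 < C ∧
      ∀ (l M N : ℕ) (d : Fin N → Fin M → ℝ) (p : Fin N → ℝ) (r₀ : Fin M → ℝ)
        (β₀ Δβ δ tol : ℝ) (fuel : ℕ), 1 ≤ l → 1 ≤ M → 1 ≤ N →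
        let s := RDTracking.rootTracking l d p r₀ β₀ Δβ δ tol fuel
        (2 ≤ l → (s.time : ℝ) ≤
          C * (RDTracking.costBound l M N * s.gridPoints + (M : ℝ) * N * s.baIters)) ∧
        (l = 1 → (s.time : ℝ) ≤
          C * ((M : ℝ) ^ 3 * N * s.gridPoints + (M : ℝ) * N * s.baIters)) ∧
        (2 ≤ l ∨ RDTracking.IsNonsingularRoot d p β₀ r₀ →
          (s.peak : ℝ) ≤ C * RDTracking.memoryBound l M N) := by
  -- The constant is dictated by `taylorTime_le`, where `64 ^ l` is absorbed; the other bounds need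
  -- at most `4000000`.
  refine ⟨4000 * 64 ^ 64, by positivity, fun l M N d p r₀ β₀ Δβ δ tol fuel hl hM hN => ?_⟩
  intro s
  have htime : s.time ≤ _ := RDTracking.time_rootTracking_le d p r₀ β₀ Δβ δ tol fuel hl hN
  have hpeak : s.peak ≤ _ := RDTracking.peak_rootTracking_le d p r₀ β₀ Δβ δ tol fuel hl hN
  have hMN : 100 * ((M + 1) * N) ≤ 200 * (M * N) := by nlinarith
  have hba : (100 * ((M + 1) * N) : ℕ) * (s.baIters : ℝ) ≤
      4000 * 64 ^ 64 * ((M : ℝ) * N * s.baIters) := by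
    have h1 : ((100 * ((M + 1) * N) : ℕ) : ℝ) ≤ 200 * (M * N) := by exact_mod_cast hMN
    calc _ ≤ 200 * ((M : ℝ) * N) * s.baIters := by gcongr
      _ = 200 * ((M : ℝ) * N * s.baIters) := by ring
      _ ≤ _ := by gcongr; norm_num
  have htime' : (s.time : ℝ) ≤ (RDTracking.taylorTime l M N + (2 * M + 3) : ℕ) * s.gridPoints +
      (100 * ((M + 1) * N) : ℕ) * s.baIters := by exact_mod_cast htime
  refine ⟨fun hl2 => ?_, fun hl1 => ?_, fun h => ?_⟩
  · have h1 : ((RDTracking.taylorTime l M N + (2 * M + 3) : ℕ) : ℝ) ≤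
        4000 * 64 ^ 64 * (N * ((M : ℝ) + l) ^ (3 * l)) := by
      exact_mod_cast RDTracking.taylorTime_le hl2 hM hN
    have h2 := RDTracking.le_costBound (N := N) hl hM
    have h3 : ((RDTracking.taylorTime l M N + (2 * M + 3) : ℕ) : ℝ) * s.gridPoints ≤
        4000 * 64 ^ 64 * (RDTracking.costBound l M N * s.gridPoints) := by
      rw [← mul_assoc]
      gcongr
      exact h1.trans (by gcongr)
    rw [mul_add]
    exact htime'.trans (add_le_add h3 hba)
  · subst hl1
    have h1 : ((RDTracking.taylorTime 1 M N + (2 * M + 3) : ℕ) : ℝ) ≤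
        4000000 * ((M : ℝ) ^ 3 * N) := by
      exact_mod_cast RDTracking.taylorTime_one_le hM hN
    have h3 : ((RDTracking.taylorTime 1 M N + (2 * M + 3) : ℕ) : ℝ) * s.gridPoints ≤
        4000 * 64 ^ 64 * ((M : ℝ) ^ 3 * N * s.gridPoints) := by
      rw [← mul_assoc]
      gcongr
      exact h1.trans (by gcongr; norm_num)
    rw [mul_add]
    exact htime'.trans (add_le_add h3 hba)
  · have hW : (Finset.univ.filter fun i => r₀ i ≠ 0).card ≤ M :=
      (Finset.card_le_univ _).trans_eq (Fintype.card_fin M)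
    have h1 := RDTracking.cells_le_memoryBound hl hM hN hW (h.imp_right fun h =>
      (h.card_support_le _ fun y => by simp).trans_eq (Fintype.card_fin N))
    have h2 : (s.peak : ℝ) ≤ _ := Nat.cast_le.2 hpeak
    have h3 : 0 ≤ RDTracking.memoryBound l M N := by
      have := Real.log_natCast_nonneg l
      rw [RDTracking.memoryBound]
      positivity
    refine (h2.trans h1).trans ?_
    gcongr
    norm_num
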